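/- **Setting.** Let $n\ge 0$, $x=(x_1,\dots,x_n)$, $y=(y_1,\dots,y_n)$, let $a=(a_i)_{i\in\mathbb Z}$, $b=(b_i)_{i\in\mathbb Z}$ be two doubly infinite sequences of parameters, and $z,w$ two further variables. Put $a'=(-a_{1-i})_{i\in\mathbb Z}$, $(t|a)^k=\prod_{i=1}^k(t-a_i)$ and $(t;a)^k=\prod_{i=1}^k(1-a_it)$ for $k\ge0$. *Six vertex model.* Every edge at a vertex is occupied ($1$) or unoccupied ($0$). A vertex with row parameters $x,y$, column parameters $a,b$ and (left, top, bottom, right) edges as listed has weight $0000\mapsto 1-bx$, $\;1111\mapsto y+a$, $\;0110\mapsto 1+by$, $\;1001\mapsto x-a$, $\;0101\mapsto 1-ab$, $\;1010\mapsto x+y$, and weight $0$ otherwise. In the dual model the weights are $0000\mapsto 1-ax$, $\;1111\mapsto y+b$, $\;0110\mapsto 1+ay$, $\;1001\mapsto x-b$, $\;1100\mapsto 1-ab$, $\;0011\mapsto x+y$, and $0$ otherwise. A partition $\lambda$ is encoded by its Maya diagram, in which $k\in\mathbb Z$ is occupied iff $k=\lambda_i-i+1$ for some $i\ge1$. Let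 $\langle\mu|A^{N,M}(x,y)|\lambda\rangle$ be the partition function of one row with columns $-N+1,\dots,M$ (column $j$ having parameters $a_j,b_j$), unoccupied leftmost and rightmost edges, and the Maya diagrams of $\mu$ and $\lambda$ restricted to these columns on the top and on the bottom; let $\widehat A^{N,M}$ be the same with the dual weights. Put $$\langle\mu|\mathcal A(x,y)|\lambda\rangle=\lim_{N,M\to\infty}\frac{\langle\mu|A^{N,M}(x,y)|\lambda\rangle}{(y;b')^N(x;b)^M},\qquad \langle\lambda|\widehat{\mathcal A}(x,y)|\mu\rangle=\lim_{N,M\to\infty}\frac{\langle\lambda|\widehat A^{N,M}(x,y)|\mu\rangle}{(y;a')^N(x;a)^M},$$ where the limits are formal: the sequences stabilize. The free fermionic Schur functions and their duals are $$s_{\lambda;a,b}(x/y)=\langle\emptyset|\mathcal A(x_1,y_1)\cdots\mathcal A(x_n,y_n)|\lambda\rangle,\qquad \widehat s_{\lambda;a,b}(x/y)=\langle\lambda|\widehat{\mathcal A}(x_1,y_1)\cdots\widehat{\mathcal A}(x_n,y_n)|\emptyset\rangle,$$ and $(p|q)=(p+1,1^q)$ denotes a hook. **Corollary (generating series for hook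 functions).** $$\text{(1)}\quad 1+(z+w)\sum_{p,q=0}^{\infty}s_{(p|q);a,b}(x/y)\,(1-a_{p+1}b_{p+1})\frac{(z|b)^p}{(z;a)^{p+1}}\frac{(w|b')^q}{(w;a')^{q+1}}=\prod_{i=1}^n\frac{1+y_iz}{1-x_iz}\,\frac{1+x_iw}{1-y_iw},$$ $$\text{(2)}\quad 1+(z+w)\sum_{p,q=0}^{\infty}\widehat s_{(p|q);a,b}(x/y)\,(1-a'_{q+1}b'_{q+1})\frac{(z|a)^p}{(z;b)^{p+1}}\frac{(w|a')^q}{(w;b')^{q+1}}=\prod_{i=1}^n\frac{1+x_iw}{1-x_iz}\,\frac{1+y_iz}{1-y_iw}.$$ These identities hold in each of the following two senses. (A) *Algebraically.* All quantities are elements of an arbitrary commutative ring (for example, complex numbers). For (1), assume that $1-b_jx_i$, $1-b'_jy_i$, $1-a_jz$, $1-a'_jw$ are invertible for all $i$ and all $j\ge1$, that either $z=b_l$ for some $l\ge1$ or $x_i=a_{l_i}$ for all $i$ with pairwise distinct $l_1,\dots,l_n\ge1$, and that either $w=b'_l$ for some $l\ge1$ or $y_i=a'_{l_i}$ for all $i$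 with pairwise distinct $l_1,\dots,l_n\ge1$. Then only finitely many terms of the sum are nonzero and (1) holds. The same is true of (2) under the same assumptions with $a$ and $b$ interchanged. (B) *Formally.* If $x_i,y_i,z,w$ $(1\le i\le n)$ and $a_j,b_j$ $(j\in\mathbb Z)$ are independent indeterminates, then for every commutative coefficient ring $k$ both sums converge (coefficientwise, with $k$ discrete) in the ring of formal power series over $k$ in all these indeterminates, and (1) and (2) hold there. -/

import Mathlib

open Filter
open scoped MvPowerSeries.WithPiTopology

namespace FreeFermionic

noncomputable section

/-- The fraction `u / v` in a commutative ring, for an invertible denominator `v`. -/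
def frac {R : Type*} [CommRing R] (u v : R) : R := u * Ring.inverse v

/-- The dual sequence `a' = (-a_{1-i})_i`. -/
def dualSeq {R : Type*} [CommRing R] (a : ℤ → R) : ℤ → R := fun i => -a (1 - i)

/-- The shifted power `(t | a)^k = (t - a_1) ⋯ (t - a_k)`. -/
def shiftedPow {R : Type*} [CommRing R] (t : R) (a : ℤ → R) (k : ℕ) : R :=
  ∏ i ∈ Finset.range k, (t - a ((i : ℤ) + 1))

/-- The shifted power `(t ; a)^k = (1 - a_1 t) ⋯ (1 - a_k t)`. -/
def coshiftedPow {R : Type*} [CommRing R] (t : R) (a : ℤ → R) (k : ℕ) : R :=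
  ∏ i ∈ Finset.range k, (1 - a ((i : ℤ) + 1) * t)

/-! ### The six vertex model

A vertex is given by the occupancy of its left, top, bottom and right edge (in this order);
`true` means occupied. -/

/-- Weights of the six vertex model (paths go right and down). The nonzero cases are the vertices
of type a₁, a₂, b₁, b₂, c₁, c₂. -/
def vertexWeight {R : Type*} [CommRing R] (x y a b : R) : Bool → Bool → Bool → Bool → R
  | false, false, false, false => 1 - b * x
  | true, true, true, true => y + a
  | false, true, true, false => 1 + b * y
  | true, false, false, true => x - a
  | false, true, false, true => 1 - a * b
  | true, false, true, false => x + y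
  | _, _, _, _ => 0

/-- Weights of the dual six vertex model (paths go left and down). The nonzero cases are the
vertices of type a₁, a₂, b₁, b₂, d₁, d₂. -/
def dualVertexWeight {R : Type*} [CommRing R] (x y a b : R) : Bool → Bool → Bool → Bool → R
  | false, false, false, false => 1 - a * x
  | true, true, true, true => y + b
  | false, true, true, false => 1 + a * y
  | true, false, false, true => x - b
  | true, true, false, false => 1 - a * b
  | false, false, true, true => x + y
  | _, _, _, _ => 0

/-- The matrix coefficient `⟨v | A | w⟩` of the row transfer operator with the columns
`-n+1, …, m`: the sum, over all choices of the internal horizontal edges, of the product of the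
vertex weights `wt j left top bottom right`, where the vertical edges on top are `v`, those at the
bottom are `w`, and the two external horizontal edges are unoccupied. It is computed as the upper
left entry of the product of the monodromy matrices of the columns. -/
def rowPartition {R : Type*} [CommRing R] (wt : ℤ → Bool → Bool → Bool → Bool → R)
    (n m : ℕ) (v w : ℤ → Bool) : R :=
  (((List.range (n + m)).map fun t : ℕ =>
      (Matrix.of fun left right : Bool =>
        wt ((t : ℤ) - n + 1) left (v ((t : ℤ) - n + 1)) (w ((t : ℤ) - n + 1)) right :
        Matrix Bool Bool R)).prod) false false

open Classical in
/-- The limit, as `n, m → ∞`, of a doubly indexed sequence that stabilizes: the value that it takes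
for all large enough `n` and `m`. -/
def stableLimit {R : Type*} [Zero R] (u : ℕ → ℕ → R) : R :=
  if h : ∃ c, ∀ᶠ p : ℕ × ℕ in atTop, u p.1 p.2 = c then h.choose else 0

theorem stableLimit_eq {R : Type*} [Zero R] {u : ℕ → ℕ → R} {c : R}
    (h : ∀ᶠ p : ℕ × ℕ in atTop, u p.1 p.2 = c) : stableLimit u = c := by
  have hex : ∃ c, ∀ᶠ p : ℕ × ℕ in atTop, u p.1 p.2 = c := ⟨c, h⟩
  unfold stableLimit
  rw [dif_pos hex]
  obtain ⟨p, h1, h2⟩ := (hex.choose_spec.and h).exists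
  exact h1.symm.trans h2

open Classical in
/-- The Maya diagram (of charge zero) of a partition: position `k` is occupied if and only if
`k = λ_i - i + 1` for some `i ≥ 1`. -/
def maya (lam : YoungDiagram) (k : ℤ) : Bool :=
  decide (∃ i : ℕ, k = (lam.rowLen i : ℤ) - i)

/-- The matrix coefficient `⟨μ | 𝒜_{a,b}(x, y) | λ⟩` of the row transfer operator with infinitely
many columns, normalized by `(y; b')^n (x; b)^m`. -/
def opA {R : Type*} [CommRing R] (a b : ℤ → R) (x y : R) (mu lam : YoungDiagram) : R :=
  stableLimit fun n m =>
    frac (rowPartition (fun j => vertexWeight x y (a j) (b j)) n m (maya mu) (maya lam))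
      (coshiftedPow y (dualSeq b) n * coshiftedPow x b m)

/-- The matrix coefficient `⟨λ | 𝒜̂_{a,b}(x, y) | μ⟩` of the dual row transfer operator with
infinitely many columns, normalized by `(y; a')^n (x; a)^m`. -/
def dualOpA {R : Type*} [CommRing R] (a b : ℤ → R) (x y : R) (lam mu : YoungDiagram) : R :=
  stableLimit fun n m =>
    frac (rowPartition (fun j => dualVertexWeight x y (a j) (b j)) n m (maya lam) (maya mu))
      (coshiftedPow y (dualSeq a) n * coshiftedPow x a m)

open Classical in
/-- The matrix coefficient `⟨ρ | K(x_1, y_1) ⋯ K(x_n, y_n) | σ⟩` of a composition of operators given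
by their matrix coefficients `⟨ρ | K(x, y) | σ⟩`. -/
def opProd {R : Type*} [CommRing R] (K : R → R → YoungDiagram → YoungDiagram → R) :
    (n : ℕ) → (Fin n → R) → (Fin n → R) → YoungDiagram → YoungDiagram → R
  | 0, _, _, rho, sigma => if rho = sigma then 1 else 0
  | n + 1, x, y, rho, sigma =>
      ∑ᶠ nu : YoungDiagram, K (x 0) (y 0) rho nu * opProd K n (Fin.tail x) (Fin.tail y) nu sigma

/-- The free fermionic Schur function
`s_{λ/μ; a,b}(x/y) = ⟨μ | 𝒜(x_1, y_1) ⋯ 𝒜(x_n, y_n) | λ⟩`. -/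
def schur {R : Type*} [CommRing R] {n : ℕ} (lam mu : YoungDiagram) (a b : ℤ → R)
    (x y : Fin n → R) : R :=
  opProd (opA a b) n x y mu lam

/-- The dual free fermionic Schur function
`ŝ_{λ/μ; a,b}(x/y) = ⟨λ | 𝒜̂(x_1, y_1) ⋯ 𝒜̂(x_n, y_n) | μ⟩`. -/
def dualSchur {R : Type*} [CommRing R] {n : ℕ} (lam mu : YoungDiagram) (a b : ℤ → R)
    (x y : Fin n → R) : R :=
  opProd (dualOpA a b) n x y lam mu

/-- The hook `(p | q) = (p + 1, 1^q)` in Frobenius notation. -/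
def hook (p q : ℕ) : YoungDiagram where
  cells := (Finset.range (p + 1)).image (fun j => (0, j)) ∪
    (Finset.range (q + 1)).image (fun i => (i, 0))
  isLowerSet := by
    rintro ⟨i, j⟩ ⟨i', j'⟩ ⟨hi, hj⟩ h
    simp only [Finset.coe_union, Finset.coe_image, Set.mem_union, Set.mem_image, Finset.mem_coe,
      Finset.mem_range, Prod.mk.injEq] at h hi hj ⊢
    rcases h with ⟨c, hc, h0, h1⟩ | ⟨c, hc, h0, h1⟩
    · exact Or.inl ⟨j', by omega, by omega, rfl⟩
    · exact Or.inr ⟨i', by omega, rfl, by omega⟩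

/-- The summand
`s_{(p|q); a,b}(x/y) (1 - a_{p+1} b_{p+1}) (z|b)^p / (z;a)^{p+1} · (w|b')^q / (w;a')^{q+1}`. -/
def hookTerm {R : Type*} [CommRing R] {n : ℕ} (a b : ℤ → R) (x y : Fin n → R) (z w : R)
    (pq : ℕ × ℕ) : R :=
  schur (hook pq.1 pq.2) ⊥ a b x y * (1 - a ((pq.1 : ℤ) + 1) * b ((pq.1 : ℤ) + 1)) *
    frac (shiftedPow z b pq.1) (coshiftedPow z a (pq.1 + 1)) *
    frac (shiftedPow w (dualSeq b) pq.2) (coshiftedPow w (dualSeq a) (pq.2 + 1))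

/-- The summand
`ŝ_{(p|q); a,b}(x/y) (1 - a'_{q+1} b'_{q+1}) (z|a)^p / (z;b)^{p+1} · (w|a')^q / (w;b')^{q+1}`. -/
def dualHookTerm {R : Type*} [CommRing R] {n : ℕ} (a b : ℤ → R) (x y : Fin n → R) (z w : R)
    (pq : ℕ × ℕ) : R :=
  dualSchur (hook pq.1 pq.2) ⊥ a b x y *
    (1 - dualSeq a ((pq.2 : ℤ) + 1) * dualSeq b ((pq.2 : ℤ) + 1)) *
    frac (shiftedPow z a pq.1) (coshiftedPow z b (pq.1 + 1)) *
    frac (shiftedPow w (dualSeq a) pq.2) (coshiftedPow w (dualSeq b) (pq.2 + 1))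

/-- All the denominators `1 - b_j x_i`, `1 - b'_j y_i`, `1 - a_j z`, `1 - a'_j w`, `j ≥ 1`, are
invertible. -/
structure Nondegenerate {R : Type*} [CommRing R] {n : ℕ} (a b : ℤ → R) (x y : Fin n → R)
    (z w : R) : Prop where
  isUnit_x : ∀ i, ∀ j : ℤ, 1 ≤ j → IsUnit (1 - b j * x i)
  isUnit_y : ∀ i, ∀ j : ℤ, 1 ≤ j → IsUnit (1 - dualSeq b j * y i)
  isUnit_z : ∀ j : ℤ, 1 ≤ j → IsUnit (1 - a j * z)
  isUnit_w : ∀ j : ℤ, 1 ≤ j → IsUnit (1 - dualSeq a j * w)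

/-- The condition under which a series in the double shifted powers of `t` breaks off: either `t` is
one of `b_1, b_2, …`, or `u_1, …, u_n` are terms of the sequence `a_1, a_2, …` with distinct
indices. -/
def BreaksOff {R : Type*} [CommRing R] {n : ℕ} (a b : ℤ → R) (u : Fin n → R) (t : R) : Prop :=
  (∃ l : ℤ, 1 ≤ l ∧ t = b l) ∨
    ∃ l : Fin n → ℤ, Function.Injective l ∧ ∀ i, 1 ≤ l i ∧ u i = a (l i)

/-- Independent indeterminates `x_1, …, x_n, y_1, …, y_n, z, w` and `a_i, b_i` for `i ∈ ℤ`. -/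
inductive Indet (n : ℕ) : Type
  | x (i : Fin n) : Indet n
  | y (i : Fin n) : Indet n
  | z : Indet n
  | w : Indet n
  | a (i : ℤ) : Indet n
  | b (i : ℤ) : Indet n

end

end FreeFermionic

namespace FreeFermionic

noncomputable section

variable {R : Type*} [CommRing R]

/-! The hook `(p | q)` is the vacuum with one particle at site `p + 1` and one hole at site `-q`.
Cut a row between the columns `0` and `1`. If the horizontal edge at the cut is occupied, the row
creates a particle-hole pair from the vacuum; if it is empty, particle and hole move independently.
Exchanging particles and holes (`sixWeight_mirror`) turns the left half into a right half with `x,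
y` swapped and `a, b` replaced by `a', b'`. Hence a row sends the amplitude `f (p, q)` to `(x + y)
e(p) e'(q) + (T ⊗ T') f`, which is the recursion `hookCore`. The hook functions differ from
`hookCore` only by a diagonal factor, `1 - a'b'` at `q` or `1 - ab` at `p` (`schur_hook`,
`dualSchur_hook`); the explicit factor in the series supplies the other one, so both identities
become one symmetric identity.

Paired with the weights `g` of `genCoeff`, telescoping gives `∑ e g = 1 / (1 - xz)` and `∑ (T s) g =
(1 + yz) / (1 - xz) ∑ s g`, up to boundary terms at the truncation (`sum_entryCoeff_mul_genCoeff`,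
`sum_passSum_mul_genCoeff`). So the double sum `F` changes by `(1 - xz)(1 - yw) F_new = (x + y) + (1
+ yz)(1 + xw) F`, and since `(x + y)(z + w) = (1 + yz)(1 + xw) - (1 - xz)(1 - yw)`, each row
multiplies `1 + (z + w) F` by its factor of the product (`sum_hookCore_mul_genCoeff`).

It remains to remove the boundary terms. For `z = b_l` they contain a vanishing shifted power. For
formal series they have order at least `m`, so the identity holds modulo every order. For `x_i =
a_{l_i}`, partial fractions write the particle amplitude as a combination of one-row amplitudes,
whose boundary terms are divided differences of vanishing products. This divides by `x_i - x_j`,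
which need not be invertible in `R`, so it is done in a universal domain and then specialized
(`edgeSum_hookCore_eq_zero`). -/

theorem frac_self {v : R} (hv : IsUnit v) : frac v v = 1 :=
  Ring.mul_inverse_cancel _ hv

theorem frac_eq_of_mul_eq {u v t : R} (hv : IsUnit v) (h : t * v = u) : frac u v = t := by
  rw [frac, ← h, mul_assoc, Ring.mul_inverse_cancel _ hv, mul_one]

theorem zero_frac (v : R) : frac 0 v = 0 := zero_mul _

/-- No invertibility is needed: `Ring.inverse` is multiplicative on a commutative ring, with value
`0` at non-units. -/
theorem frac_mul_frac (u v u' v' : R) : frac u v * frac u' v' = frac (u * u') (v * v') := by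
  simp only [frac, Ring.mul_inverse_rev]
  ring

theorem prod_frac {ι : Type*} (s : Finset ι) (u v : ι → R) :
    ∏ i ∈ s, frac (u i) (v i) = frac (∏ i ∈ s, u i) (∏ i ∈ s, v i) := by
  classical
  induction s using Finset.induction_on with
  | empty => simp [frac]
  | insert i s hi ih => rw [Finset.prod_insert hi, Finset.prod_insert hi, Finset.prod_insert hi, ih,
      frac_mul_frac]

theorem map_inverse_of_isUnit {S : Type*} [CommRing S] (f : R →+* S) {v : R} (hv : IsUnit v) :
    f (Ring.inverse v) = Ring.inverse (f v) := by
  obtain ⟨u, rfl⟩ := hv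
  have h : f (u : R) = ((Units.map (f : R →* S) u : Sˣ) : S) := rfl
  rw [h, Ring.inverse_unit, Ring.inverse_unit]
  rfl

theorem map_frac {S : Type*} [CommRing S] (f : R →+* S) (u : R) {v : R} (hv : IsUnit v) :
    f (frac u v) = frac (f u) (f v) := by
  rw [frac, frac, map_mul, map_inverse_of_isUnit f hv]

/-! ### Transfer of a single particle on a half line, and the hook recursion -/

/-- The normalized shifted power `∏_{i < p} (x - A_i) / (1 - B_i x)`. -/
def ratioPow (A B : ℕ → R) (x : R) (p : ℕ) : R :=
  ∏ i ∈ Finset.range p, frac (x - A i) (1 - B i * x)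

/-- The weight of a path that starts at the particle `i` and arrives horizontally at column `p`. -/
def edgeCoeff (A B : ℕ → R) (x : R) (i p : ℕ) : R :=
  frac (1 - A i * B i) (1 - B i * x) * ∏ j ∈ Finset.Ico (i + 1) p, frac (x - A j) (1 - B j * x)

/-- The linear functional that sums the weights of the paths arriving horizontally at column `p`. -/
def edgeSum (A B : ℕ → R) (x : R) (s : ℕ → R) (p : ℕ) : R :=
  ∑ i ∈ Finset.range p, s i * edgeCoeff A B x i p

/-- The matrix coefficient of the passage of one particle from column `i` to column `p`. -/
def passCoeff (A B : ℕ → R) (x y : R) (i p : ℕ) : R :=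
  if i = p then frac (1 + B p * y) (1 - B p * x)
  else edgeCoeff A B x i p * frac (x + y) (1 - B p * x)

/-- The action of one row on the amplitudes of the position of one particle. -/
def passSum (A B : ℕ → R) (x y : R) (s : ℕ → R) (p : ℕ) : R :=
  ∑ i ∈ Finset.range (p + 1), s i * passCoeff A B x y i p

/-- The amplitude of the position of a particle created by a row. -/
def entryCoeff (A B : ℕ → R) (x : R) (p : ℕ) : R :=
  ratioPow A B x p * Ring.inverse (1 - B p * x)

/-- The hook functions up to the factor depending on the hook only. -/
def hookCore (A B A' B' : ℕ → R) : (n : ℕ) → (Fin n → R) → (Fin n → R) → ℕ → ℕ → R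
  | 0, _, _, _, _ => 0
  | n + 1, x, y, p, q =>
      (x 0 + y 0) * (entryCoeff A B (x 0) p * entryCoeff A' B' (y 0) q) +
        passSum A B (x 0) (y 0) (fun i =>
          passSum A' B' (y 0) (x 0) (hookCore A B A' B' n (Fin.tail x) (Fin.tail y) i) q) p

/-- The generating weight `(1 - A_p B_p) (z|B)^p / (z;A)^{p+1}`. -/
def genCoeff (A B : ℕ → R) (z : R) (p : ℕ) : R :=
  ratioPow B A z p * frac (1 - A p * B p) (1 - A p * z)

theorem ratioPow_succ (A B : ℕ → R) (x : R) (p : ℕ) :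
    ratioPow A B x (p + 1) = ratioPow A B x p * frac (x - A p) (1 - B p * x) :=
  Finset.prod_range_succ _ _

theorem edgeSum_zero (A B : ℕ → R) (x : R) (s : ℕ → R) : edgeSum A B x s 0 = 0 := by
  simp [edgeSum]

/-- A path leaving column `p` horizontally either arrived horizontally or is the particle of column
`p` setting off. -/
theorem edgeSum_succ (A B : ℕ → R) (x : R) (s : ℕ → R) (p : ℕ) :
    edgeSum A B x s (p + 1) = edgeSum A B x s p * frac (x - A p) (1 - B p * x) +
      s p * frac (1 - A p * B p) (1 - B p * x) := by
  rw [edgeSum, Finset.sum_range_succ, edgeSum, Finset.sum_mul]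
  congr 1
  · refine Finset.sum_congr rfl fun i hi => ?_
    rw [edgeCoeff, Finset.prod_Ico_succ_top (by simp at hi; omega), edgeCoeff]
    ring
  · simp [edgeCoeff]

/-- A particle below column `p` was already above it, or arrives horizontally and turns down. -/
theorem passSum_eq (A B : ℕ → R) (x y : R) (s : ℕ → R) (p : ℕ) :
    passSum A B x y s p = s p * frac (1 + B p * y) (1 - B p * x) +
      edgeSum A B x s p * frac (x + y) (1 - B p * x) := by
  rw [passSum, Finset.sum_range_succ, edgeSum, Finset.sum_mul, add_comm]
  congr 1
  · simp [passCoeff]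
  · refine Finset.sum_congr rfl fun i hi => ?_
    rw [passCoeff, if_neg (by simp at hi; omega)]
    ring

theorem edgeSum_linear {ι : Type*} (t : Finset ι) (A B : ℕ → R) (x : R) (u : ι → ℕ → R)
    (c : ι → R) (p : ℕ) :
    edgeSum A B x (fun i => ∑ k ∈ t, u k i * c k) p = ∑ k ∈ t, edgeSum A B x (u k) p * c k := by
  simp only [edgeSum, Finset.sum_mul]
  rw [Finset.sum_comm]
  exact Finset.sum_congr rfl fun _ _ => Finset.sum_congr rfl fun _ _ => by ring

theorem passSum_linear {ι : Type*} (t : Finset ι) (A B : ℕ → R) (x y : R) (u : ι → ℕ → R)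
    (c : ι → R) (p : ℕ) :
    passSum A B x y (fun i => ∑ k ∈ t, u k i * c k) p =
      ∑ k ∈ t, passSum A B x y (u k) p * c k := by
  simp only [passSum, Finset.sum_mul]
  rw [Finset.sum_comm]
  exact Finset.sum_congr rfl fun _ _ => Finset.sum_congr rfl fun _ _ => by ring

theorem edgeSum_passSum (A B A' B' : ℕ → R) (x x' y' : R) (s : ℕ → ℕ → R) (p q : ℕ) :
    edgeSum A B x (fun i => passSum A' B' x' y' (s i) q) p =
      passSum A' B' x' y' (fun j => edgeSum A B x (fun i => s i j) p) q := by
  unfold passSum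
  rw [edgeSum_linear]

theorem passSum_comm (A B A' B' : ℕ → R) (x y x' y' : R) (s : ℕ → ℕ → R) (p q : ℕ) :
    passSum A B x y (fun i => passSum A' B' x' y' (s i) q) p =
      passSum A' B' x' y' (fun j => passSum A B x y (fun i => s i j) p) q := by
  conv_lhs => enter [5, i]; rw [passSum]
  rw [passSum_linear]
  rfl

/-- The two passages act on different indices and commute, so particle and hole play symmetric
roles. This transfers statements about `p` and `z` to `q` and `w`. -/
theorem hookCore_swap (A B A' B' : ℕ → R) (n : ℕ) (x y : Fin n → R) (p q : ℕ) :
    hookCore A' B' A B n y x q p = hookCore A B A' B' n x y p q := by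
  induction n generalizing p q with
  | zero => rfl
  | succ n ih =>
    simp only [hookCore]
    rw [passSum_comm]
    have h : (fun i j => hookCore A' B' A B n (Fin.tail y) (Fin.tail x) j i) =
        hookCore A B A' B' n (Fin.tail x) (Fin.tail y) := by
      funext i j
      exact ih _ _ _ _
    have h' : ∀ i, (fun j => hookCore A' B' A B n (Fin.tail y) (Fin.tail x) j i) =
        hookCore A B A' B' n (Fin.tail x) (Fin.tail y) i := fun i => congrFun h i
    simp only [h']
    ring

/-! ### Truncated generating series -/

/-- Telescoping in `m`: `genCoeff` is an eigenvector of the transposed passage, with eigenvalue `(1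
+ yz) / (1 - xz)`, up to the paths that are still horizontal on arrival at column `m`. -/
theorem sum_passSum_mul_genCoeff {A B : ℕ → R} {x z : R} (y : R)
    (hx : ∀ p, IsUnit (1 - B p * x)) (hz : ∀ p, IsUnit (1 - A p * z)) (s : ℕ → R) (m : ℕ) :
    (1 - x * z) * ∑ p ∈ Finset.range m, passSum A B x y s p * genCoeff A B z p =
      (1 + y * z) * ∑ p ∈ Finset.range m, s p * genCoeff A B z p -
        (x + y) * (edgeSum A B x s m * ratioPow B A z m) := by
  induction m with
  | zero => simp [edgeSum_zero]
  | succ m ih =>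
    rw [Finset.sum_range_succ, Finset.sum_range_succ, mul_add, ih, passSum_eq, edgeSum_succ,
      ratioPow_succ, genCoeff]
    have hi := Ring.mul_inverse_cancel _ (hx m)
    have hj := Ring.mul_inverse_cancel _ (hz m)
    simp only [frac]
    -- With the inverses as free variables subject only to `hi` and `hj`, the claim is a polynomial
    -- identity.
    generalize Ring.inverse (1 - B m * x) = i at *
    generalize Ring.inverse (1 - A m * z) = j at *
    generalize edgeSum A B x s m = E
    generalize ratioPow B A z m = e
    linear_combination ((x + y) * E * e * ((1 - A m * z) * j) +
      s m * e * (1 - A m * B m) * j * (1 + y * z)) * hi + (x + y) * E * e * hj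

/-- The sum telescopes because `(1 - xz)(1 - AB) = (1 - Bx)(1 - Az) - (x - A)(z - B)`. -/
theorem sum_entryCoeff_mul_genCoeff {A B : ℕ → R} {x z : R}
    (hx : ∀ p, IsUnit (1 - B p * x)) (hz : ∀ p, IsUnit (1 - A p * z)) (m : ℕ) :
    (1 - x * z) * ∑ p ∈ Finset.range m, entryCoeff A B x p * genCoeff A B z p =
      1 - ratioPow A B x m * ratioPow B A z m := by
  induction m with
  | zero => simp [ratioPow]
  | succ m ih =>
    rw [Finset.sum_range_succ, mul_add, ih, ratioPow_succ, ratioPow_succ, genCoeff, entryCoeff]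
    have hi := Ring.mul_inverse_cancel _ (hx m)
    have hj := Ring.mul_inverse_cancel _ (hz m)
    simp only [frac]
    generalize Ring.inverse (1 - B m * x) = i at *
    generalize Ring.inverse (1 - A m * z) = j at *
    generalize ratioPow A B x m = E
    generalize ratioPow B A z m = e
    linear_combination (E * e * ((1 - A m * z) * j)) * hi + E * e * hj

/-- The vanishing of the remainder terms after truncation at `m`. -/
def RemainderVanishes (A B A' B' : ℕ → R) (z : R) (m : ℕ) :
    (n : ℕ) → (Fin n → R) → (Fin n → R) → Prop
  | 0, _, _ => True
  | n + 1, x, y => ratioPow A B (x 0) m * ratioPow B A z m = 0 ∧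
      (∀ q, edgeSum A B (x 0) (fun p => hookCore A B A' B' n (Fin.tail x) (Fin.tail y) p q) m *
        ratioPow B A z m = 0) ∧
      RemainderVanishes A B A' B' z m n (Fin.tail x) (Fin.tail y)

theorem sum_hookCore_mul_genCoeff {A B A' B' : ℕ → R} {z w : R} {m : ℕ} {n : ℕ} {x y : Fin n → R}
    (hx : ∀ i p, IsUnit (1 - B p * x i)) (hy : ∀ i p, IsUnit (1 - B' p * y i))
    (hz : ∀ p, IsUnit (1 - A p * z)) (hw : ∀ p, IsUnit (1 - A' p * w))
    (h : RemainderVanishes A B A' B' z m n x y) (h' : RemainderVanishes A' B' A B w m n y x) :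
    (∏ i, (1 - x i * z) * (1 - y i * w)) *
      (1 + (z + w) * ∑ p ∈ Finset.range m, ∑ q ∈ Finset.range m,
        hookCore A B A' B' n x y p q * genCoeff A B z p * genCoeff A' B' w q) =
      ∏ i, (1 + y i * z) * (1 + x i * w) := by
  induction n with
  | zero => simp [hookCore]
  | succ n ih =>
    obtain ⟨h1, h2, h3⟩ := h
    obtain ⟨h1', h2', h3'⟩ := h'
    have key := ih (x := Fin.tail x) (y := Fin.tail y) (fun i => hx _) (fun i => hy _) h3 h3'
    rw [Fin.prod_univ_succ, Fin.prod_univ_succ]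
    simp only [Fin.tail] at key
    rw [← key]
    simp only [hookCore]
    set s := hookCore A B A' B' n (Fin.tail x) (Fin.tail y) with hs
    have hs' : (fun i j => hookCore A' B' A B n (Fin.tail y) (Fin.tail x) j i) = s := by
      funext i j
      exact hookCore_swap _ _ _ _ _ _ _ _ _
    have h2s : ∀ p, edgeSum A' B' (y 0) (s p) m * ratioPow B' A' w m = 0 := fun p => by
      rw [← h2' p, ← hs']
    set g := genCoeff A B z
    set g' := genCoeff A' B' w
    have e1 : ∑ p ∈ Finset.range m, ∑ q ∈ Finset.range m,
        ((x 0 + y 0) * (entryCoeff A B (x 0) p * entryCoeff A' B' (y 0) q) +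
          passSum A B (x 0) (y 0) (fun i => passSum A' B' (y 0) (x 0) (s i) q) p) * g p * g' q =
        (x 0 + y 0) * ((∑ p ∈ Finset.range m, entryCoeff A B (x 0) p * g p) *
          (∑ q ∈ Finset.range m, entryCoeff A' B' (y 0) q * g' q)) +
        ∑ q ∈ Finset.range m, (∑ p ∈ Finset.range m,
          passSum A B (x 0) (y 0) (fun i => passSum A' B' (y 0) (x 0) (s i) q) p * g p) * g' q := by
      generalize x 0 + y 0 = c
      simp only [add_mul, Finset.sum_add_distrib]
      congr 1
      · rw [Finset.sum_mul_sum, Finset.mul_sum]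
        refine Finset.sum_congr rfl fun p _ => ?_
        rw [Finset.mul_sum]
        exact Finset.sum_congr rfl fun q _ => by ring
      · rw [Finset.sum_comm]
        exact Finset.sum_congr rfl fun q _ => by rw [Finset.sum_mul]
    -- Sum over `p` first. The boundary term is `edgeSum` in the first index after a passage in the
    -- second; these commute, so `h2` kills it for each value of the second index.
    have e2 : (1 - x 0 * z) * ∑ q ∈ Finset.range m, (∑ p ∈ Finset.range m,
          passSum A B (x 0) (y 0) (fun i => passSum A' B' (y 0) (x 0) (s i) q) p * g p) * g' q =
        (1 + y 0 * z) * ∑ p ∈ Finset.range m, g p * ∑ q ∈ Finset.range m,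
          passSum A' B' (y 0) (x 0) (s p) q * g' q := by
      have : ∀ q : ℕ, (1 - x 0 * z) * ((∑ p ∈ Finset.range m,
          passSum A B (x 0) (y 0) (fun i => passSum A' B' (y 0) (x 0) (s i) q) p * g p) * g' q) =
          (1 + y 0 * z) * ∑ p ∈ Finset.range m,
            g p * (passSum A' B' (y 0) (x 0) (s p) q * g' q) := by
        intro q
        rw [← mul_assoc, sum_passSum_mul_genCoeff _ (hx 0) hz, edgeSum_passSum]
        have : passSum A' B' (y 0) (x 0)
            (fun j => edgeSum A B (x 0) (fun i => s i j) m) q * ratioPow B A z m = 0 := by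
          rw [passSum, Finset.sum_mul]
          refine Finset.sum_eq_zero fun j _ => ?_
          linear_combination passCoeff A' B' (y 0) (x 0) j q * h2 j
        rw [this, mul_zero, sub_zero, mul_assoc, Finset.sum_mul]
        congr 1
        exact Finset.sum_congr rfl fun p _ => by ring
      rw [Finset.mul_sum, Finset.sum_congr rfl fun q _ => this q, ← Finset.mul_sum,
        Finset.sum_comm]
      simp only [Finset.mul_sum]
    have e3 : (1 - y 0 * w) * ∑ p ∈ Finset.range m, g p * ∑ q ∈ Finset.range m,
          passSum A' B' (y 0) (x 0) (s p) q * g' q =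
        (1 + x 0 * w) * ∑ p ∈ Finset.range m, ∑ q ∈ Finset.range m, s p q * g p * g' q := by
      rw [Finset.mul_sum, Finset.mul_sum]
      refine Finset.sum_congr rfl fun p _ => ?_
      rw [mul_left_comm, sum_passSum_mul_genCoeff _ (hy 0) hw, h2s, mul_zero, sub_zero,
        mul_left_comm, Finset.mul_sum]
      congr 1
      exact Finset.sum_congr rfl fun p _ => by ring
    have e4 := sum_entryCoeff_mul_genCoeff (hx 0) hz m
    have e5 := sum_entryCoeff_mul_genCoeff (hy 0) hw m
    rw [h1, sub_zero] at e4
    rw [h1', sub_zero] at e5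
    rw [e1]
    generalize (∑ p ∈ Finset.range m, entryCoeff A B (x 0) p * g p) = u1 at *
    generalize (∑ p ∈ Finset.range m, entryCoeff A' B' (y 0) p * g' p) = u2 at *
    generalize (∑ p ∈ Finset.range m, ∑ q ∈ Finset.range m, s p q * g p * g' q) = F at *
    generalize (∑ q ∈ Finset.range m, (∑ p ∈ Finset.range m,
          passSum A B (x 0) (y 0) (fun i => passSum A' B' (y 0) (x 0) (s i) q) p * g p) * g' q)
        = G at *
    generalize (∑ p ∈ Finset.range m, g p * ∑ q ∈ Finset.range m,
          passSum A' B' (y 0) (x 0) (s p) q * g' q) = H at *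
    -- The identity used is `(x₀ + y₀)(z + w) = (1 + y₀z)(1 + x₀w) - (1 - x₀z)(1 - y₀w)`.
    linear_combination (∏ i : Fin n, (1 - x i.succ * z) * (1 - y i.succ * w)) * (z + w) *
      ((x 0 + y 0) * (e4 * u2 * (1 - y 0 * w) + e5) + (1 - y 0 * w) * e2 + (1 + y 0 * z) * e3)

/-! ### Boundary terms by partial fractions -/

/-- A row acting on a one-row amplitude yields a divided difference; the telescoping rests on `(x -
A)(1 - Bx') - (x' - A)(1 - Bx) = (x - x')(1 - AB)`. -/
theorem sub_mul_edgeSum_entryCoeff {A B : ℕ → R} {x x' : R} (hx : ∀ p, IsUnit (1 - B p * x))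
    (hx' : ∀ p, IsUnit (1 - B p * x')) (m : ℕ) :
    (x - x') * edgeSum A B x' (entryCoeff A B x) m = ratioPow A B x m - ratioPow A B x' m := by
  induction m with
  | zero => simp [edgeSum_zero, ratioPow]
  | succ m ih =>
    rw [edgeSum_succ, ratioPow_succ, ratioPow_succ, entryCoeff]
    have hi := Ring.mul_inverse_cancel _ (hx m)
    have hj := Ring.mul_inverse_cancel _ (hx' m)
    simp only [frac]
    generalize Ring.inverse (1 - B m * x) = i at *
    generalize Ring.inverse (1 - B m * x') = j at *
    generalize ratioPow A B x m = u at *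
    generalize ratioPow A B x' m = u' at *
    linear_combination (x' - A m) * j * ih - u * (x' - A m) * j * hi + u * (x - A m) * i * hj

theorem sub_mul_passSum_entryCoeff {A B : ℕ → R} {x x' : R} (y : R)
    (hx : ∀ p, IsUnit (1 - B p * x)) (hx' : ∀ p, IsUnit (1 - B p * x')) (p : ℕ) :
    (x - x') * passSum A B x' y (entryCoeff A B x) p =
      (x + y) * entryCoeff A B x p - (x' + y) * entryCoeff A B x' p := by
  have ih := sub_mul_edgeSum_entryCoeff hx hx' (A := A) p
  rw [passSum_eq, entryCoeff, entryCoeff]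
  have hi := Ring.mul_inverse_cancel _ (hx p)
  have hj := Ring.mul_inverse_cancel _ (hx' p)
  simp only [frac]
  generalize Ring.inverse (1 - B p * x) = i at *
  generalize Ring.inverse (1 - B p * x') = j at *
  generalize ratioPow A B x p = u at *
  generalize ratioPow A B x' p = u' at *
  linear_combination (x' + y) * j * ih - (x' + y) * u * j * hi + (x + y) * u * i * hj

/-- By `sub_mul_passSum_entryCoeff`, a row with parameter `x 0` maps each `entryCoeff A B (x i)`
into the span of itself and `entryCoeff A B (x 0)`. Thus the dependence on `p` stays in the span of
the one-row amplitudes. -/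
theorem exists_hookCore_eq_sum {A B A' B' : ℕ → R} {n : ℕ} {x y : Fin n → R}
    (hx : ∀ i p, IsUnit (1 - B p * x i)) (hxx : ∀ i j, i ≠ j → IsUnit (x i - x j)) :
    ∃ M : Fin n → ℕ → R, ∀ p q,
      hookCore A B A' B' n x y p q = ∑ i, entryCoeff A B (x i) p * M i q := by
  induction n with
  | zero => exact ⟨fun _ _ => 0, fun p q => by simp [hookCore]⟩
  | succ n ih =>
    obtain ⟨M, hM⟩ := ih (x := Fin.tail x) (y := Fin.tail y) (fun i => hx _)
      (fun i j h => hxx _ _ (by simpa using h))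
    -- `N` carries the partial fraction denominators `x_i - x_0`; the subtracted halves of the
    -- divided differences all go into the coefficient of the new row.
    let N : Fin n → ℕ → R := fun i q =>
      passSum A' B' (y 0) (x 0) (M i) q * Ring.inverse (x i.succ - x 0)
    refine ⟨Fin.cons (fun q => (x 0 + y 0) * (entryCoeff A' B' (y 0) q - ∑ i, N i q))
      (fun i q => (x i.succ + y 0) * N i q), fun p q => ?_⟩
    have h1 : ∀ i, passSum A' B' (y 0) (x 0)
        (hookCore A B A' B' n (Fin.tail x) (Fin.tail y) i) q =
        ∑ k, entryCoeff A B (x (Fin.succ k)) i * passSum A' B' (y 0) (x 0) (M k) q := fun i => by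
      have : hookCore A B A' B' n (Fin.tail x) (Fin.tail y) i =
          fun q => ∑ k, M k q * entryCoeff A B (x (Fin.succ k)) i := by
        funext q
        rw [hM]
        exact Finset.sum_congr rfl fun _ _ => mul_comm _ _
      rw [this, passSum_linear]
      exact Finset.sum_congr rfl fun _ _ => mul_comm _ _
    simp only [hookCore, h1]
    rw [passSum_linear, Fin.sum_univ_succ]
    simp only [Fin.cons_zero, Fin.cons_succ]
    have h2 : ∀ k : Fin n, passSum A B (x 0) (y 0) (entryCoeff A B (x k.succ)) p *
        passSum A' B' (y 0) (x 0) (M k) q =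
        entryCoeff A B (x k.succ) p * ((x k.succ + y 0) * N k q) -
          entryCoeff A B (x 0) p * (x 0 + y 0) * N k q := fun k => by
      have hu := Ring.mul_inverse_cancel _ (hxx k.succ 0 (Fin.succ_ne_zero k))
      have := sub_mul_passSum_entryCoeff (A := A) (y 0) (hx k.succ) (hx 0) p
      simp only [N]
      linear_combination passSum A' B' (y 0) (x 0) (M k) q * Ring.inverse (x k.succ - x 0) * this
        - passSum A B (x 0) (y 0) (entryCoeff A B (x k.succ)) p *
          passSum A' B' (y 0) (x 0) (M k) q * hu
    rw [Finset.sum_congr rfl fun k _ => h2 k, Finset.sum_sub_distrib, ← Finset.mul_sum]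
    ring

theorem edgeSum_hookCore_eq_zero_of_isUnit {A B A' B' : ℕ → R} {n : ℕ} {x₀ : R} {x y : Fin n → R}
    (hx₀ : ∀ p, IsUnit (1 - B p * x₀)) (hx : ∀ i p, IsUnit (1 - B p * x i))
    (hxx₀ : ∀ i, IsUnit (x i - x₀)) (hxx : ∀ i j, i ≠ j → IsUnit (x i - x j)) {m : ℕ}
    (h₀ : ratioPow A B x₀ m = 0) (h : ∀ i, ratioPow A B (x i) m = 0) (q : ℕ) :
    edgeSum A B x₀ (fun p => hookCore A B A' B' n x y p q) m = 0 := by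
  obtain ⟨M, hM⟩ := exists_hookCore_eq_sum (A := A) (A' := A') (B' := B') (y := y) hx hxx
  simp only [hM]
  rw [edgeSum_linear]
  refine Finset.sum_eq_zero fun i _ => ?_
  have := sub_mul_edgeSum_entryCoeff (A := A) (hx i) hx₀ m
  rw [h, h₀, sub_zero] at this
  rw [(hxx₀ i).mul_right_eq_zero.mp this, zero_mul]

/-! ### Base change -/

section Map

variable {S : Type*} [CommRing S] (f : R →+* S)

theorem map_ratioPow {A B : ℕ → R} {x : R} (hx : ∀ p, IsUnit (1 - B p * x)) (p : ℕ) :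
    f (ratioPow A B x p) = ratioPow (fun i => f (A i)) (fun i => f (B i)) (f x) p := by
  simp [ratioPow, map_frac f _ (hx _)]

theorem map_edgeCoeff {A B : ℕ → R} {x : R} (hx : ∀ p, IsUnit (1 - B p * x)) (i p : ℕ) :
    f (edgeCoeff A B x i p) = edgeCoeff (fun i => f (A i)) (fun i => f (B i)) (f x) i p := by
  simp [edgeCoeff, map_frac f _ (hx _)]

theorem map_edgeSum {A B : ℕ → R} {x : R} (hx : ∀ p, IsUnit (1 - B p * x)) (s : ℕ → R) (p : ℕ) :
    f (edgeSum A B x s p) =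
      edgeSum (fun i => f (A i)) (fun i => f (B i)) (f x) (fun i => f (s i)) p := by
  simp [edgeSum, map_edgeCoeff f hx]

theorem map_passCoeff {A B : ℕ → R} {x : R} (y : R) (hx : ∀ p, IsUnit (1 - B p * x)) (i p : ℕ) :
    f (passCoeff A B x y i p) =
      passCoeff (fun i => f (A i)) (fun i => f (B i)) (f x) (f y) i p := by
  unfold passCoeff
  split_ifs
  · simp [map_frac f _ (hx _)]
  · simp [map_frac f _ (hx _), map_edgeCoeff f hx]

theorem map_passSum {A B : ℕ → R} {x : R} (y : R) (hx : ∀ p, IsUnit (1 - B p * x)) (s : ℕ → R)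
    (p : ℕ) : f (passSum A B x y s p) =
      passSum (fun i => f (A i)) (fun i => f (B i)) (f x) (f y) (fun i => f (s i)) p := by
  simp [passSum, map_passCoeff f y hx]

theorem map_entryCoeff {A B : ℕ → R} {x : R} (hx : ∀ p, IsUnit (1 - B p * x)) (p : ℕ) :
    f (entryCoeff A B x p) = entryCoeff (fun i => f (A i)) (fun i => f (B i)) (f x) p := by
  simp [entryCoeff, map_ratioPow f hx, map_inverse_of_isUnit f (hx p)]

theorem map_genCoeff {A B : ℕ → R} {z : R} (hz : ∀ p, IsUnit (1 - A p * z)) (p : ℕ) :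
    f (genCoeff A B z p) = genCoeff (fun i => f (A i)) (fun i => f (B i)) (f z) p := by
  simp [genCoeff, map_ratioPow f hz, map_frac f _ (hz p)]

theorem map_hookCore {A B A' B' : ℕ → R} {n : ℕ} {x y : Fin n → R}
    (hx : ∀ i p, IsUnit (1 - B p * x i)) (hy : ∀ i p, IsUnit (1 - B' p * y i)) (p q : ℕ) :
    f (hookCore A B A' B' n x y p q) =
      hookCore (fun i => f (A i)) (fun i => f (B i)) (fun i => f (A' i)) (fun i => f (B' i)) n
        (fun i => f (x i)) (fun i => f (y i)) p q := by
  induction n generalizing p q with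
  | zero => simp [hookCore]
  | succ n ih =>
    have ih' : ∀ i, (fun j => f (hookCore A B A' B' n (Fin.tail x) (Fin.tail y) i j)) = _ :=
      fun i => funext fun j => ih (x := Fin.tail x) (y := Fin.tail y) (fun _ => hx _)
        (fun _ => hy _) i j
    simp only [hookCore, map_add, map_mul, map_entryCoeff f (hx 0), map_entryCoeff f (hy 0),
      map_passSum f _ (hx 0), map_passSum f _ (hy 0), ih']
    rfl

end Map

/-! ### Boundary terms when the `x_i` are distinct terms of `A` -/

/-- Indeterminates for the parameters of the rows with `x_i = A_{l_i}`. -/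
inductive ParamIndet (n : ℕ) : Type
  | A (p : ℕ) : ParamIndet n
  | B (p : ℕ) : ParamIndet n
  | A' (p : ℕ) : ParamIndet n
  | B' (p : ℕ) : ParamIndet n
  | y (i : Fin n) : ParamIndet n

theorem ratioPow_eq_zero {A B : ℕ → R} {l m : ℕ} (h : l < m) : ratioPow A B (A l) m = 0 :=
  Finset.prod_eq_zero (Finset.mem_range.mpr h) (by simp [frac])

/-- Specialization from the universal case: there the `A_{l_i}` are distinct indeterminates, so
their differences are invertible in a field and the partial fraction argument applies. -/
theorem edgeSum_hookCore_eq_zero {A B A' B' : ℕ → R} {n : ℕ} {l₀ : ℕ} {l : Fin n → ℕ}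
    {y : Fin n → R} (hx₀ : ∀ p, IsUnit (1 - B p * A l₀)) (hx : ∀ i p, IsUnit (1 - B p * A (l i)))
    (hy : ∀ i p, IsUnit (1 - B' p * y i))
    (hl₀ : ∀ i, l i ≠ l₀) (hl : Function.Injective l) {m : ℕ} (hm₀ : l₀ < m) (hm : ∀ i, l i < m)
    (q : ℕ) :
    edgeSum A B (A l₀) (fun p => hookCore A B A' B' n (fun i => A (l i)) y p q) m = 0 := by
  rcases subsingleton_or_nontrivial R with hR | hR
  · exact Subsingleton.elim _ _
  let P := MvPolynomial (ParamIndet n) ℤ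
  let v : ParamIndet n → R
    | .A p => A p
    | .B p => B p
    | .A' p => A' p
    | .B' p => B' p
    | .y i => y i
  let φ : P →+* R := (MvPolynomial.aeval v).toRingHom
  have hφ : ∀ s, φ (MvPolynomial.X s) = v s := fun s => MvPolynomial.aeval_X v s
  -- Exactly the polynomials whose value in `R` is a unit are inverted. As `R` is nontrivial, `0` is
  -- not among them, so `D` is a domain; all needed denominators are units in it, and evaluation
  -- extends to `ψ : D →+* R`.
  let M : Submonoid P := (IsUnit.submonoid R).comap φ
  have hM : M ≤ nonZeroDivisors P := le_nonZeroDivisors_of_noZeroDivisors fun h => by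
    have h' : IsUnit (φ 0) := h
    rw [map_zero] at h'
    exact not_isUnit_zero h'
  let D := Localization M
  have : IsDomain D := IsLocalization.isDomain_localization hM
  obtain ⟨K, _, κ, hκ⟩ : ∃ (K : Type) (_ : Field K) (κ : D →+* K), Function.Injective κ :=
    ⟨FractionRing D, inferInstance, algebraMap D _, IsFractionRing.injective D _⟩
  let ψ : D →+* R := IsLocalization.lift (M := M) (g := φ) fun u => u.2
  let ι : P →+* D := algebraMap P D
  have hψ : ∀ t, ψ (ι t) = φ t := fun t => IsLocalization.lift_eq _ t
  have hι : Function.Injective ι := IsLocalization.injective D hM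
  have hunit : ∀ t, IsUnit (φ t) → IsUnit (ι t) := fun t ht =>
    IsLocalization.map_units D (⟨t, ht⟩ : M)
  have hunit2 : ∀ s t : ParamIndet n, IsUnit (1 - v s * v t) →
      IsUnit (1 - ι (.X s) * ι (.X t)) := fun s t h => by
    rw [← map_mul, ← map_one ι, ← map_sub]
    exact hunit _ (by simpa [hφ] using h)
  set X : ParamIndet n → D := fun s => ι (.X s) with hX
  have hXinj : Function.Injective (fun s => κ (X s)) :=
    hκ.comp (hι.comp (MvPolynomial.X_injective))
  have hxD : ∀ i p, IsUnit (1 - X (.B p) * X (.A (l i))) := fun i p => hunit2 _ _ (hx i p)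
  have hx₀D : ∀ p, IsUnit (1 - X (.B p) * X (.A l₀)) := fun p => hunit2 _ _ (hx₀ p)
  have hyD : ∀ i p, IsUnit (1 - X (.B' p) * X (.y i)) := fun i p => hunit2 _ _ (hy i p)
  have hKunit : ∀ s t : ParamIndet n, IsUnit (1 - X s * X t) →
      IsUnit (1 - κ (X s) * κ (X t)) := fun s t h => by
    simpa using h.map κ
  have hKsub : ∀ i j : ℕ, i ≠ j → IsUnit (κ (X (.A i)) - κ (X (.A j))) := fun i j hij => by
    refine isUnit_iff_ne_zero.mpr (sub_ne_zero.mpr fun h => hij ?_)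
    exact ParamIndet.A.inj (hXinj h)
  have zeroK := edgeSum_hookCore_eq_zero_of_isUnit (R := K) (A := fun p => κ (X (.A p)))
    (B := fun p => κ (X (.B p))) (A' := fun p => κ (X (.A' p))) (B' := fun p => κ (X (.B' p)))
    (x₀ := κ (X (.A l₀))) (x := fun i => κ (X (.A (l i)))) (y := fun i => κ (X (.y i)))
    (fun p => hKunit _ _ (hx₀D p)) (fun i p => hKunit _ _ (hxD i p))
    (fun i => hKsub _ _ (hl₀ i)) (fun i j hij => hKsub _ _ fun h => hij (hl h))
    (m := m) (ratioPow_eq_zero hm₀) (fun i => ratioPow_eq_zero (A := fun p => κ (X (.A p))) (hm i))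
    q
  have zeroD : edgeSum (fun p => X (.A p)) (fun p => X (.B p)) (X (.A l₀)) (fun p =>
      hookCore (fun p => X (.A p)) (fun p => X (.B p)) (fun p => X (.A' p)) (fun p => X (.B' p)) n
        (fun i => X (.A (l i))) (fun i => X (.y i)) p q) m = 0 := by
    apply hκ
    rw [map_zero, map_edgeSum κ hx₀D, ← zeroK]
    congr 1
    funext p
    exact map_hookCore κ hxD hyD p q
  have hR := congrArg ψ zeroD
  rw [map_zero, map_edgeSum ψ hx₀D] at hR
  simp only [map_hookCore ψ hxD hyD] at hR
  simpa only [hX, hψ, hφ, v] using hR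

/-- The outermost row puts a particle at `p` by creation, by keeping it there, or by a horizontal
arrival. These contributions vanish by `ratioPow_eq_zero`, by induction and by
`edgeSum_hookCore_eq_zero`. -/
theorem hookCore_eq_zero {A B A' B' : ℕ → R} {n : ℕ} {l : Fin n → ℕ}
    {y : Fin n → R} (hx : ∀ i p, IsUnit (1 - B p * A (l i)))
    (hy : ∀ i p, IsUnit (1 - B' p * y i)) (hl : Function.Injective l) {p : ℕ}
    (hp : ∀ i, l i < p) (q : ℕ) :
    hookCore A B A' B' n (fun i => A (l i)) y p q = 0 := by
  induction n generalizing q with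
  | zero => rfl
  | succ n ih =>
    have hl' : Function.Injective (fun i => l (Fin.succ i)) :=
      hl.comp (Fin.succ_injective n)
    have h1 : ∀ j, hookCore A B A' B' n (fun i => A (l (Fin.succ i))) (Fin.tail y) p j = 0 :=
      fun j => ih (fun i => hx _) (fun i => hy _) hl' (fun i => hp _) j
    have h2 : ∀ j, edgeSum A B (A (l 0)) (fun i => hookCore A B A' B' n
        (fun i => A (l (Fin.succ i))) (Fin.tail y) i j) p = 0 := fun j =>
      edgeSum_hookCore_eq_zero (hx 0) (fun i => hx _) (fun i => hy _)
        (fun i h => Fin.succ_ne_zero i (hl h)) hl' (hp 0) (fun i => hp _) j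
    have h3 : (Fin.tail fun i => A (l i)) = fun i => A (l (Fin.succ i)) := rfl
    have h0 : ∀ r : ℕ → R, (∀ j, r j = 0) → ∀ q, passSum A' B' (y 0) (A (l 0)) r q = 0 :=
      fun r hr q => Finset.sum_eq_zero fun j _ => by rw [hr, zero_mul]
    rw [hookCore, h3, entryCoeff, ratioPow_eq_zero (hp 0), passSum_eq, edgeSum_passSum,
      h0 _ h1, h0 _ h2]
    ring

theorem remainderVanishes_of_ratioPow {A B A' B' : ℕ → R} {z : R} {m : ℕ}
    (h : ratioPow B A z m = 0) (n : ℕ) (x y : Fin n → R) :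
    RemainderVanishes A B A' B' z m n x y := by
  induction n with
  | zero => trivial
  | succ n ih => exact ⟨by rw [h, mul_zero], fun q => by rw [h, mul_zero], ih _ _⟩

theorem remainderVanishes_of_injective {A B A' B' : ℕ → R} {z : R} {n : ℕ} {l : Fin n → ℕ}
    {y : Fin n → R} (hx : ∀ i p, IsUnit (1 - B p * A (l i)))
    (hy : ∀ i p, IsUnit (1 - B' p * y i)) (hl : Function.Injective l) {m : ℕ}
    (hm : ∀ i, l i < m) : RemainderVanishes A B A' B' z m n (fun i => A (l i)) y := by
  induction n with
  | zero => trivial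
  | succ n ih =>
    have hl' : Function.Injective (fun i => l (Fin.succ i)) :=
      hl.comp (Fin.succ_injective n)
    refine ⟨by rw [ratioPow_eq_zero (hm 0), zero_mul], fun q => ?_, ?_⟩
    · have := edgeSum_hookCore_eq_zero (A' := A') (hx 0) (fun i => hx (Fin.succ i))
        (fun i => hy (Fin.succ i)) (fun i h => Fin.succ_ne_zero i (hl h)) hl' (hm 0)
        (fun i => hm _) q
      exact mul_eq_zero_of_left this _
    · exact ih (fun i => hx (Fin.succ i)) (fun i => hy (Fin.succ i)) hl' (fun i => hm _)

/-! ### Maya diagrams of hooks -/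

theorem rowLen_hook (p q i : ℕ) :
    (hook p q).rowLen i = if i = 0 then p + 1 else if i ≤ q then 1 else 0 := by
  have hmem : ∀ j, j < (hook p q).rowLen i ↔ ((i = 0 ∧ j ≤ p) ∨ (j = 0 ∧ i ≤ q)) := fun j => by
    rw [← YoungDiagram.mem_iff_lt_rowLen, ← YoungDiagram.mem_cells]
    simp only [hook, Finset.mem_union, Finset.mem_image, Finset.mem_range, Prod.mk.injEq]
    constructor
    · rintro (⟨c, hc, h0, h1⟩ | ⟨c, hc, h0, h1⟩)
      · exact Or.inl ⟨by omega, by omega⟩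
      · exact Or.inr ⟨by omega, by omega⟩
    · rintro (⟨h0, h1⟩ | ⟨h0, h1⟩)
      · exact Or.inl ⟨j, by omega, by omega, rfl⟩
      · exact Or.inr ⟨i, by omega, rfl, by omega⟩
  refine eq_of_forall_lt_iff fun j => ?_
  rw [hmem]
  split_ifs <;> omega

theorem rowLen_bot (i : ℕ) : (⊥ : YoungDiagram).rowLen i = 0 := by
  by_contra h
  exact YoungDiagram.notMem_bot _
    (YoungDiagram.mem_iff_lt_rowLen.mpr (Nat.pos_of_ne_zero h) : ((i, 0) : ℕ × ℕ) ∈ ⊥)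

theorem maya_eq_true {lam : YoungDiagram} {k : ℤ} :
    maya lam k = true ↔ ∃ i : ℕ, k = (lam.rowLen i : ℤ) - i := by
  simp [maya]

/-- The sequence `i - λ_i` is strictly increasing, hence determined by its range, the negated
occupied set. -/
theorem maya_injective : Function.Injective maya := by
  intro lam mu h
  have hmono : ∀ nu : YoungDiagram, StrictMono fun i : ℕ => (i : ℤ) - nu.rowLen i :=
    fun nu i j hij => by
      have := nu.rowLen_anti i j hij.le
      simp only
      omega
  have hrange : ∀ nu : YoungDiagram, Set.range (fun i : ℕ => (i : ℤ) - nu.rowLen i) =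
      {k | maya nu (-k) = true} := fun nu => by
    ext k
    simp only [Set.mem_range, Set.mem_ofPred_eq, maya_eq_true]
    exact exists_congr fun i => by omega
  have heq := ((hmono lam).range_inj (hmono mu)).mp (by rw [hrange, hrange, h])
  refine YoungDiagram.ext (Finset.ext fun ⟨i, j⟩ => ?_)
  have hi := congrFun heq i
  rw [YoungDiagram.mem_cells, YoungDiagram.mem_cells, YoungDiagram.mem_iff_lt_rowLen,
    YoungDiagram.mem_iff_lt_rowLen]
  omega

theorem maya_bot_pos (i : ℕ) : maya ⊥ ((i : ℤ) + 1) = false := by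
  rw [← Bool.not_eq_true, maya_eq_true]
  rintro ⟨k, hk⟩
  rw [rowLen_bot] at hk
  omega

theorem maya_bot_neg (i : ℕ) : maya ⊥ (-(i : ℤ)) = true :=
  maya_eq_true.mpr ⟨i, by rw [rowLen_bot]; omega⟩

theorem maya_hook_pos (p q i : ℕ) : maya (hook p q) ((i : ℤ) + 1) = decide (i = p) := by
  rw [Bool.eq_iff_iff, maya_eq_true, decide_eq_true_iff]
  constructor
  · rintro ⟨k, hk⟩
    rw [rowLen_hook] at hk
    split_ifs at hk <;> push_cast at hk <;> omega
  · rintro rfl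
    exact ⟨0, by simp [rowLen_hook]⟩

theorem maya_hook_neg (p q i : ℕ) : maya (hook p q) (-(i : ℤ)) = !decide (i = q) := by
  rw [Bool.eq_iff_iff, maya_eq_true, Bool.not_eq_true', decide_eq_false_iff_not]
  constructor
  · rintro ⟨k, hk⟩
    rw [rowLen_hook] at hk
    split_ifs at hk <;> push_cast at hk <;> omega
  · intro hi
    rcases lt_or_gt_of_ne hi with h | h
    · refine ⟨i + 1, ?_⟩
      rw [rowLen_hook, if_neg (by omega), if_pos (by omega)]
      push_cast
      omega
    · refine ⟨i, ?_⟩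
      rw [rowLen_hook, if_neg (by omega), if_neg (by omega)]
      simp

theorem maya_eq_false_of_rowLen_le {lam : YoungDiagram} {i : ℕ} (h : lam.rowLen 0 ≤ i) :
    maya lam ((i : ℤ) + 1) = false := by
  rw [← Bool.not_eq_true, maya_eq_true]
  rintro ⟨k, hk⟩
  have := lam.rowLen_anti 0 k (Nat.zero_le k)
  omega

theorem maya_eq_true_of_colLen_le {lam : YoungDiagram} {i : ℕ} (h : lam.colLen 0 ≤ i) :
    maya lam (-(i : ℤ)) = true := by
  refine maya_eq_true.mpr ⟨i, ?_⟩
  have : lam.rowLen i = 0 := by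
    by_contra h0
    have := YoungDiagram.mem_iff_lt_rowLen.mpr (Nat.pos_of_ne_zero h0)
    rw [YoungDiagram.mem_iff_lt_colLen] at this
    omega
  omega

theorem maya_ext {lam mu : YoungDiagram}
    (hpos : ∀ i : ℕ, maya lam ((i : ℤ) + 1) = maya mu ((i : ℤ) + 1))
    (hneg : ∀ i : ℕ, maya lam (-(i : ℤ)) = maya mu (-(i : ℤ))) : lam = mu := by
  refine maya_injective (funext fun k => ?_)
  rcases lt_or_ge 0 k with h | h
  · have := hpos (k - 1).toNat
    rwa [show (((k - 1).toNat : ℤ) + 1) = k by omega] at this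
  · have := hneg (-k).toNat
    rwa [show (-((-k).toNat : ℤ)) = k by omega] at this

theorem hook_ne_bot (p q : ℕ) : hook p q ≠ ⊥ := fun h => by
  have := rowLen_hook p q 0
  rw [h, rowLen_bot] at this
  simp at this

theorem hook_injective : Function.Injective fun pq : ℕ × ℕ => hook pq.1 pq.2 := by
  rintro ⟨p, q⟩ ⟨p', q'⟩ h
  simp only at h
  have h1 := maya_hook_pos p q p
  have h2 := maya_hook_neg p q q
  rw [h, maya_hook_pos] at h1
  rw [h, maya_hook_neg] at h2
  simp at h1 h2
  exact Prod.ext h1 h2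

/-! ### Products of monodromy matrices with a deterministic path -/

/-- If each matrix has only one possible exit from the current state, the sum over paths has a
single term. -/
theorem prod_matrix_apply (M : ℕ → Matrix Bool Bool R) (h : ℕ → Bool) (k : ℕ)
    (hM : ∀ t < k, ∀ r, r ≠ h (t + 1) → M t (h t) r = 0) (r : Bool) :
    ((List.range k).map M).prod (h 0) r =
      if r = h k then ∏ t ∈ Finset.range k, M t (h t) (h (t + 1)) else 0 := by
  induction k generalizing r with
  | zero =>
    simp only [List.range_zero, List.map_nil, List.prod_nil, Finset.range_zero, Finset.prod_empty,
      Matrix.one_apply, eq_comm]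
  | succ k ih =>
    rw [List.range_succ, List.map_append, List.prod_append, List.map_singleton,
      List.prod_singleton, Matrix.mul_apply]
    simp only [ih fun t ht => hM t (by omega)]
    simp only [ite_mul, zero_mul, Finset.sum_ite_eq', Finset.mem_univ, if_true]
    split_ifs with hr
    · rw [Finset.prod_range_succ, hr]
    · rw [hM k (by omega) r hr, mul_zero]

theorem exists_path_of_prod_matrix_ne_zero (M : ℕ → Matrix Bool Bool R) (k : ℕ) (l r : Bool)
    (hM : ((List.range k).map M).prod l r ≠ 0) :
    ∃ h : ℕ → Bool, h 0 = l ∧ h k = r ∧ ∀ t < k, M t (h t) (h (t + 1)) ≠ 0 := by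
  induction k generalizing r with
  | zero =>
    refine ⟨fun _ => l, rfl, ?_, fun t ht => absurd ht (Nat.not_lt_zero t)⟩
    by_contra hlr
    simp only [List.range_zero, List.map_nil, List.prod_nil] at hM
    exact hM (Matrix.one_apply_ne hlr)
  | succ k ih =>
    rw [List.range_succ, List.map_append, List.prod_append, List.map_singleton,
      List.prod_singleton, Matrix.mul_apply] at hM
    obtain ⟨s, -, hs⟩ := Finset.exists_ne_zero_of_sum_ne_zero hM
    obtain ⟨h, h0, hk, hh⟩ := ih s (left_ne_zero_of_mul hs)
    refine ⟨fun t => if t = k + 1 then r else h t, by simpa using h0, by simp, fun t ht => ?_⟩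
    rcases Nat.lt_succ_iff_lt_or_eq.mp ht with ht | rfl
    · simpa [show t ≠ k + 1 by omega, show t ≠ k by omega] using hh t ht
    · simpa [hk] using right_ne_zero_of_mul hs

/-- The window is cut between the columns `0` and `1`, and both halves are enumerated outwards from
the cut. -/
theorem prod_range_int_window (F : ℤ → R) (n m : ℕ) :
    ∏ t ∈ Finset.range (n + m), F ((t : ℤ) - n + 1) =
      (∏ i ∈ Finset.range n, F (-(i : ℤ))) * ∏ i ∈ Finset.range m, F ((i : ℤ) + 1) := by
  rw [Finset.prod_range_add]
  congr 1
  · rw [← Finset.prod_range_reflect]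
    refine Finset.prod_congr rfl fun i hi => ?_
    have := Finset.mem_range.mp hi
    congr 1
    omega
  · refine Finset.prod_congr rfl fun i _ => ?_
    congr 1
    push_cast
    ring

/-! ### Six vertex weights with general weights of the vertices of type c -/

/-- The weights of the six vertex model, with `c` and `d` the weights of the types c₁ and c₂. -/
def sixWeight (x y a b c d : R) : Bool → Bool → Bool → Bool → R
  | false, false, false, false => 1 - b * x
  | true, true, true, true => y + a
  | false, true, true, false => 1 + b * y
  | true, false, false, true => x - a
  | false, true, false, true => c
  | true, false, true, false => d
  | _, _, _, _ => 0

theorem vertexWeight_eq (x y a b : R) :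
    vertexWeight x y a b = sixWeight x y a b (1 - a * b) (x + y) := by
  funext l t u r
  cases l <;> cases t <;> cases u <;> cases r <;> rfl

theorem dualVertexWeight_eq (x y a b : R) (l t u r : Bool) :
    dualVertexWeight x y a b l t u r = sixWeight x y b a (x + y) (1 - b * a) l u t r := by
  cases l <;> cases t <;> cases u <;> cases r <;>
    simp [dualVertexWeight, sixWeight, mul_comm]

/-- Exchange of particles and holes. -/
theorem sixWeight_mirror (x y a b c d : R) (l t u r : Bool) :
    sixWeight x y a b c d l t u r = sixWeight y x (-a) (-b) d c r (!t) (!u) l := by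
  cases l <;> cases t <;> cases u <;> cases r <;> simp [sixWeight] <;> ring

theorem conservation_of_sixWeight_ne_zero {x y a b c d : R} {l t u r : Bool}
    (h : sixWeight x y a b c d l t u r ≠ 0) : l.toNat + t.toNat = u.toNat + r.toNat := by
  cases l <;> cases t <;> cases u <;> cases r <;> first | rfl | exact absurd rfl h

/-- The normalized matrix coefficient of a row of the six vertex model, on infinitely many
columns. -/
def rowOp (x y : R) (a b c d : ℤ → R) (mu lam : YoungDiagram) : R :=
  stableLimit fun n m =>
    frac (rowPartition (fun j => sixWeight x y (a j) (b j) (c j) (d j)) n m (maya mu) (maya lam))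
      (coshiftedPow y (dualSeq b) n * coshiftedPow x b m)

theorem opA_eq_rowOp (a b : ℤ → R) (x y : R) (mu lam : YoungDiagram) :
    opA a b x y mu lam = rowOp x y a b (fun j => 1 - a j * b j) (fun _ => x + y) mu lam := by
  simp only [opA, rowOp, vertexWeight_eq]

/-- Turning a dual row upside down makes its d-vertices c-vertices and exchanges `a` with `b`. The
c₁ and c₂ weights trade places compared with `opA_eq_rowOp`. -/
theorem dualOpA_eq_rowOp (a b : ℤ → R) (x y : R) (lam mu : YoungDiagram) :
    dualOpA a b x y lam mu = rowOp x y b a (fun _ => x + y) (fun j => 1 - b j * a j) mu lam := by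
  simp only [dualOpA, rowOp, rowPartition, dualVertexWeight_eq]

/-- The terms of a sequence at the positions `1, 2, …`. -/
def positivePart (a : ℤ → R) (i : ℕ) : R := a ((i : ℤ) + 1)

theorem positivePart_dualSeq (a : ℤ → R) (i : ℕ) :
    positivePart (dualSeq a) i = -a (-(i : ℤ)) := by
  simp [positivePart, dualSeq]

/-- The normalized product of the weights of the first `p` columns of a half line. -/
def halfWeight (x y : R) (A B C D : ℕ → R) (h v w : ℕ → Bool) (p : ℕ) : R :=
  ∏ i ∈ Finset.range p,
    frac (sixWeight x y (A i) (B i) (C i) (D i) (h i) (v i) (w i) (h (i + 1))) (1 - B i * x)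

theorem halfWeight_eq_of_le {x y : R} {A B C D : ℕ → R} {h v w : ℕ → Bool} {p m : ℕ}
    (hB : ∀ i, IsUnit (1 - B i * x)) (hpm : p ≤ m)
    (htriv : ∀ i, p ≤ i → h i = false ∧ v i = false ∧ w i = false) :
    halfWeight x y A B C D h v w m = halfWeight x y A B C D h v w p := by
  refine (Finset.prod_subset (Finset.range_mono hpm) fun i _ hi => ?_).symm
  have hpi : p ≤ i := by simpa using hi
  obtain ⟨h1, h2, h3⟩ := htriv i hpi
  rw [h1, h2, h3, (htriv (i + 1) (by omega)).1]
  exact frac_self (hB i)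

/-- Particle conservation forces the horizontal edges, here `h` to the right and `g` to the left of
the cut. Beyond `p` and `q` every vertex weight cancels its normalizing factor, so the limit is
attained. -/
theorem rowOp_eq_mul_halfWeight {x y : R} {a b c d : ℤ → R} {mu lam : YoungDiagram}
    (hx : ∀ i, IsUnit (1 - positivePart b i * x))
    (hy : ∀ i, IsUnit (1 - positivePart (dualSeq b) i * y))
    {h g : ℕ → Bool} (hg : h 0 = g 0) {p q : ℕ}
    (hcons : ∀ i : ℕ, (h i).toNat + (maya mu ((i : ℤ) + 1)).toNat =
      (maya lam ((i : ℤ) + 1)).toNat + (h (i + 1)).toNat)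
    (gcons : ∀ i : ℕ, (g i).toNat + (!maya mu (-(i : ℤ))).toNat =
      (!maya lam (-(i : ℤ))).toNat + (g (i + 1)).toNat)
    (htriv : ∀ i : ℕ, p ≤ i → h i = false ∧ maya mu ((i : ℤ) + 1) = false ∧
      maya lam ((i : ℤ) + 1) = false)
    (gtriv : ∀ i : ℕ, q ≤ i → g i = false ∧ (!maya mu (-(i : ℤ))) = false ∧
      (!maya lam (-(i : ℤ))) = false) :
    rowOp x y a b c d mu lam =
      halfWeight y x (positivePart (dualSeq a)) (positivePart (dualSeq b)) (fun i => d (-(i : ℤ)))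
        (fun i => c (-(i : ℤ))) g (fun i => !maya mu (-(i : ℤ))) (fun i => !maya lam (-(i : ℤ))) q *
      halfWeight x y (positivePart a) (positivePart b) (positivePart c) (positivePart d) h
        (fun i => maya mu ((i : ℤ) + 1)) (fun i => maya lam ((i : ℤ) + 1)) p := by
  refine stableLimit_eq ?_
  filter_upwards [eventually_ge_atTop (q, p)] with ⟨n, m⟩ hnm
  obtain ⟨hqn, hpm⟩ := Prod.mk_le_mk.mp hnm
  -- `e j` is the left edge of column `j`; the cut is `e 1 = h 0 = g 0`.
  let e : ℤ → Bool := fun j => if 1 ≤ j then h (j - 1).toNat else g (1 - j).toNat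
  have epos : ∀ i : ℕ, e ((i : ℤ) + 1) = h i := fun i => by
    simp only [e]
    rw [if_pos (by omega)]
    congr 1
    omega
  have eneg : ∀ i : ℕ, e (1 - (i : ℤ)) = g i := fun i => by
    rcases Nat.eq_zero_or_pos i with rfl | hi
    · simpa [e] using hg
    · simp only [e]
      rw [if_neg (by omega)]
      congr 1
      omega
  have econs : ∀ j, (e j).toNat + (maya mu j).toNat = (maya lam j).toNat + (e (j + 1)).toNat := by
    intro j
    rcases lt_or_ge 0 j with hj | hj
    · obtain ⟨i, rfl⟩ : ∃ i : ℕ, j = (i : ℤ) + 1 := ⟨(j - 1).toNat, by omega⟩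
      have := epos (i + 1)
      push_cast at this
      rw [this, epos, hcons]
    · obtain ⟨i, rfl⟩ : ∃ i : ℕ, j = -(i : ℤ) := ⟨(-j).toNat, by omega⟩
      have h1 := eneg (i + 1)
      have h2 := eneg i
      rw [show (1 : ℤ) - ((i + 1 : ℕ) : ℤ) = -(i : ℤ) by push_cast; ring] at h1
      rw [show (1 : ℤ) - (i : ℤ) = -(i : ℤ) + 1 by ring] at h2
      rw [h1, h2]
      have := gcons i
      revert this
      cases g i <;> cases g (i + 1) <;> cases maya mu (-(i : ℤ)) <;> cases maya lam (-(i : ℤ)) <;>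
        simp
  let F : ℤ → R := fun j =>
    sixWeight x y (a j) (b j) (c j) (d j) (e j) (maya mu j) (maya lam j) (e (j + 1))
  have hrow : rowPartition (fun j => sixWeight x y (a j) (b j) (c j) (d j)) n m (maya mu)
      (maya lam) = ∏ t ∈ Finset.range (n + m), F ((t : ℤ) - n + 1) := by
    have hpath := prod_matrix_apply
      (fun t : ℕ => (Matrix.of fun left right : Bool =>
        sixWeight x y (a ((t : ℤ) - n + 1)) (b ((t : ℤ) - n + 1)) (c ((t : ℤ) - n + 1))
          (d ((t : ℤ) - n + 1)) left (maya mu ((t : ℤ) - n + 1)) (maya lam ((t : ℤ) - n + 1)) right :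
        Matrix Bool Bool R)) (fun t : ℕ => e ((t : ℤ) - n + 1)) (n + m) (by
          intro t _ r hr
          by_contra hne
          have h1 := conservation_of_sixWeight_ne_zero hne
          have h2 := econs ((t : ℤ) - n + 1)
          apply hr
          push_cast
          rw [show (t : ℤ) + 1 - n + 1 = (t : ℤ) - n + 1 + 1 by ring]
          revert h1 h2
          generalize e ((t : ℤ) - n + 1 + 1) = r'
          cases r <;> cases r' <;> simp <;> omega) false
    have h0 : e (((0 : ℕ) : ℤ) - n + 1) = false := by
      have := eneg n
      rw [(gtriv n hqn).1] at this
      rw [← this]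
      congr 1
      push_cast
      ring
    have h1 : e (((n + m : ℕ) : ℤ) - n + 1) = false := by
      have := epos m
      rw [(htriv m hpm).1] at this
      rw [← this]
      congr 1
      push_cast
      ring
    rw [h0, h1, if_pos rfl] at hpath
    rw [rowPartition, hpath]
    refine Finset.prod_congr rfl fun t _ => ?_
    simp only [F, Matrix.of_apply]
    congr 2
    push_cast
    ring
  rw [hrow, prod_range_int_window, ← frac_mul_frac, ← halfWeight_eq_of_le hx hpm htriv,
    ← halfWeight_eq_of_le hy hqn gtriv]
  unfold halfWeight
  rw [coshiftedPow, coshiftedPow, ← prod_frac, ← prod_frac]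
  congr 1
  · refine Finset.prod_congr rfl fun i _ => ?_
    have h1 := eneg (i + 1)
    have h2 := eneg i
    rw [show (1 : ℤ) - ((i + 1 : ℕ) : ℤ) = -(i : ℤ) by push_cast; ring] at h1
    rw [show (1 : ℤ) - (i : ℤ) = -(i : ℤ) + 1 by ring] at h2
    simp only [F]
    rw [h1, h2, sixWeight_mirror, positivePart_dualSeq, positivePart_dualSeq,
      ← positivePart_dualSeq b]
    rfl
  · refine Finset.prod_congr rfl fun i _ => ?_
    have := epos (i + 1)
    push_cast at this
    simp only [F]
    rw [this, epos]
    rfl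

/-! ### Matrix coefficients between the empty diagram and hooks -/

theorem halfWeight_entry {x y : R} {A B C D : ℕ → R} (p : ℕ) :
    halfWeight x y A B C D (fun i => decide (i ≤ p)) (fun _ => false) (fun i => decide (i = p))
      (p + 1) = D p * entryCoeff A B x p := by
  rw [halfWeight, Finset.prod_range_succ, entryCoeff, ratioPow, mul_left_comm]
  congr 1
  · refine Finset.prod_congr rfl fun i hi => ?_
    have hi' := Finset.mem_range.mp hi
    simp [sixWeight, hi'.le, hi'.ne, Nat.succ_le_of_lt hi']
  · simp [sixWeight, frac]

/-- The normalized weight of the passage of one particle from column `i` to column `p`. -/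
def stepCoeff (x y : R) (A B C D : ℕ → R) (i p : ℕ) : R :=
  if i = p then frac (1 + B p * y) (1 - B p * x)
  else frac (C i) (1 - B i * x) *
    (∏ j ∈ Finset.Ico (i + 1) p, frac (x - A j) (1 - B j * x)) * frac (D p) (1 - B p * x)

theorem halfWeight_step {x y : R} {A B C D : ℕ → R} (hB : ∀ i, IsUnit (1 - B i * x)) {k p : ℕ}
    (hkp : k ≤ p) :
    halfWeight x y A B C D (fun i => decide (k < i ∧ i ≤ p)) (fun i => decide (i = k))
      (fun i => decide (i = p)) (p + 1) = stepCoeff x y A B C D k p := by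
  have h0 : ∏ i ∈ Finset.range k, frac (sixWeight x y (A i) (B i) (C i) (D i)
      (decide (k < i ∧ i ≤ p)) (decide (i = k)) (decide (i = p)) (decide (k < i + 1 ∧ i + 1 ≤ p)))
      (1 - B i * x) = 1 := by
    refine Finset.prod_eq_one fun i hi => ?_
    have hi' := Finset.mem_range.mp hi
    rw [decide_eq_false (by omega), decide_eq_false (by omega), decide_eq_false (by omega),
      decide_eq_false (by omega)]
    exact frac_self (hB i)
  rw [halfWeight, Finset.prod_range_succ, stepCoeff]
  split_ifs with h
  · subst h
    rw [h0, one_mul]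
    simp [sixWeight]
  · rw [← Finset.prod_range_mul_prod_Ico _ hkp, h0, one_mul,
      Finset.prod_eq_prod_Ico_succ_bot (lt_of_le_of_ne hkp h)]
    congr 1
    · congr 1
      · rw [decide_eq_false (by omega), decide_eq_true (by omega), decide_eq_false (by omega),
          decide_eq_true (by omega)]
        rfl
      · refine Finset.prod_congr rfl fun i hi => ?_
        have hi' := Finset.mem_Ico.mp hi
        rw [decide_eq_true (by omega), decide_eq_false (by omega), decide_eq_false (by omega),
          decide_eq_true (by omega)]
        rfl
    · rw [decide_eq_true (by omega), decide_eq_false (by omega), decide_eq_true (by omega),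
        decide_eq_false (by omega)]
      rfl

theorem maya_bot_neg_not (i : ℕ) : (!maya ⊥ (-(i : ℤ))) = false := by rw [maya_bot_neg]; rfl

theorem maya_hook_neg_not (p q i : ℕ) : (!maya (hook p q) (-(i : ℤ))) = decide (i = q) := by
  rw [maya_hook_neg, Bool.not_not]

theorem rowOp_bot_bot {x y : R} {a b c d : ℤ → R}
    (hx : ∀ i, IsUnit (1 - positivePart b i * x))
    (hy : ∀ i, IsUnit (1 - positivePart (dualSeq b) i * y)) :
    rowOp x y a b c d ⊥ ⊥ = 1 := by
  rw [rowOp_eq_mul_halfWeight hx hy (h := fun _ => false) (g := fun _ => false) rfl (p := 0)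
    (q := 0)]
  · simp [halfWeight]
  all_goals simp [maya_bot_pos, maya_bot_neg]

/-- The cut edge is occupied: its path turns down at `p + 1` on the right, and on the left it
emerges from the site `-q`, leaving the hole. -/
theorem rowOp_bot_hook {x y : R} {a b c d : ℤ → R}
    (hx : ∀ i, IsUnit (1 - positivePart b i * x))
    (hy : ∀ i, IsUnit (1 - positivePart (dualSeq b) i * y)) (p q : ℕ) :
    rowOp x y a b c d ⊥ (hook p q) =
    c (-(q : ℤ)) * d ((p : ℤ) + 1) * (entryCoeff (positivePart a) (positivePart b) x p *
      entryCoeff (positivePart (dualSeq a)) (positivePart (dualSeq b)) y q) := by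
  rw [rowOp_eq_mul_halfWeight hx hy (h := fun i => decide (i ≤ p)) (g := fun i => decide (i ≤ q))
    (by simp) (p := p + 1) (q := q + 1)]
  · simp only [maya_bot_pos, maya_bot_neg_not, maya_hook_pos, maya_hook_neg_not, halfWeight_entry]
    simp only [positivePart]
    ring
  · intro i
    simp only [maya_bot_pos, maya_hook_pos]
    rcases lt_trichotomy i p with h | rfl | h
    · simp [h.le, h.ne, Nat.succ_le_of_lt h]
    · simp
    · simp [h.not_ge, h.ne', show ¬ i + 1 ≤ p by omega]
  · intro i
    simp only [maya_bot_neg_not, maya_hook_neg_not]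
    rcases lt_trichotomy i q with h | rfl | h
    · simp [h.le, h.ne, Nat.succ_le_of_lt h]
    · simp
    · simp [h.not_ge, h.ne', show ¬ i + 1 ≤ q by omega]
  · intro i hi
    simp only [maya_bot_pos, maya_hook_pos, decide_eq_false_iff_not, true_and]
    omega
  · intro i hi
    simp only [maya_bot_neg_not, maya_hook_neg_not, decide_eq_false_iff_not, true_and]
    omega

theorem step_conservation {k p : ℕ} (hkp : k ≤ p) (i : ℕ) :
    (decide (k < i ∧ i ≤ p)).toNat + (decide (i = k)).toNat =
      (decide (i = p)).toNat + (decide (k < i + 1 ∧ i + 1 ≤ p)).toNat := by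
  have h : ∀ (P : Prop) [Decidable P], (decide P).toNat = if P then 1 else 0 := fun P _ => by
    split_ifs with hP <;> simp [hP]
  simp only [h]
  split_ifs <;> omega

/-- The cut edge is empty, so the particle steps from `k` to `p` and the hole from `l` to `q`
independently. -/
theorem rowOp_hook_hook {x y : R} {a b c d : ℤ → R}
    (hx : ∀ i, IsUnit (1 - positivePart b i * x))
    (hy : ∀ i, IsUnit (1 - positivePart (dualSeq b) i * y))
    {k l p q : ℕ} (hkp : k ≤ p) (hlq : l ≤ q) :
    rowOp x y a b c d (hook k l) (hook p q) =
      stepCoeff y x (positivePart (dualSeq a)) (positivePart (dualSeq b)) (fun i => d (-(i : ℤ)))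
        (fun i => c (-(i : ℤ))) l q *
      stepCoeff x y (positivePart a) (positivePart b) (positivePart c) (positivePart d) k p := by
  rw [rowOp_eq_mul_halfWeight hx hy (h := fun i => decide (k < i ∧ i ≤ p))
    (g := fun i => decide (l < i ∧ i ≤ q)) (by simp) (p := p + 1) (q := q + 1)]
  · simp only [maya_hook_pos, maya_hook_neg_not, halfWeight_step hx hkp, halfWeight_step hy hlq]
  · intro i
    simp only [maya_hook_pos, step_conservation hkp]
  · intro i
    simp only [maya_hook_neg_not, step_conservation hlq]
  · intro i hi
    simp only [maya_hook_pos, decide_eq_false_iff_not]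
    omega
  · intro i hi
    simp only [maya_hook_neg_not, decide_eq_false_iff_not]
    omega

/-! ### Vanishing of the other matrix coefficients -/

theorem eq_false_of_conservation {h v : ℕ → Bool} {m : ℕ} (hm : h m = false)
    (hcons : ∀ i < m, (h i).toNat + (v i).toNat = (h (i + 1)).toNat) :
    h 0 = false ∧ ∀ i < m, v i = false := by
  induction m generalizing h v with
  | zero => exact ⟨hm, fun i hi => absurd hi (Nat.not_lt_zero i)⟩
  | succ m ih =>
    obtain ⟨h1, h2⟩ := ih (h := fun i => h (i + 1)) (v := fun i => v (i + 1)) hm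
      fun i hi => hcons (i + 1) (by omega)
    have h0 := hcons 0 (by omega)
    rw [h1] at h0
    have h3 : h 0 = false ∧ v 0 = false := by
      revert h0
      cases h 0 <;> cases v 0 <;> simp
    refine ⟨h3.1, fun i hi => ?_⟩
    rcases i with _ | i
    · exact h3.2
    · exact h2 i (by omega)

/-- The particle leaving at `p` came either through the cut or from one site `k ≤ p` above, and no
other can be present because none leaves at the far end. -/
theorem config_of_conservation {h v : ℕ → Bool} {m p : ℕ} (hm : h m = false) (hpm : p < m)
    (hcons : ∀ i < m, (h i).toNat + (v i).toNat = (decide (i = p)).toNat + (h (i + 1)).toNat) :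
    (h 0 = true ∧ ∀ i < m, v i = false) ∨
      (h 0 = false ∧ ∃ k ≤ p, ∀ i < m, v i = decide (i = k)) := by
  induction p generalizing h v m with
  | zero =>
    obtain ⟨m, rfl⟩ : ∃ m', m = m' + 1 := ⟨m - 1, by omega⟩
    obtain ⟨h1, h2⟩ := eq_false_of_conservation (h := fun i => h (i + 1))
      (v := fun i => v (i + 1)) hm fun i hi => by simpa using hcons (i + 1) (by omega)
    have h0 := hcons 0 (by omega)
    rw [h1] at h0
    have h3 : (h 0 = true ∧ v 0 = false) ∨ (h 0 = false ∧ v 0 = true) := by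
      revert h0
      cases h 0 <;> cases v 0 <;> simp
    rcases h3 with ⟨h3, h4⟩ | ⟨h3, h4⟩
    · refine Or.inl ⟨h3, fun i hi => ?_⟩
      rcases i with _ | i
      · exact h4
      · exact h2 i (by omega)
    · refine Or.inr ⟨h3, 0, le_rfl, fun i hi => ?_⟩
      rcases i with _ | i
      · simpa using h4
      · simpa using h2 i (by omega)
  | succ p ih =>
    obtain ⟨m, rfl⟩ : ∃ m', m = m' + 1 := ⟨m - 1, by omega⟩
    have h0 := hcons 0 (by omega)
    rw [decide_eq_false (by omega)] at h0
    rcases ih (h := fun i => h (i + 1)) (v := fun i => v (i + 1)) (m := m) hm (by omega)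
      (fun i hi => by simpa using hcons (i + 1) (by omega)) with ⟨h1, h2⟩ | ⟨h1, k, hk, h2⟩
    · rw [h1] at h0
      have h3 : (h 0 = true ∧ v 0 = false) ∨ (h 0 = false ∧ v 0 = true) := by
        revert h0
        cases h 0 <;> cases v 0 <;> simp
      rcases h3 with ⟨h3, h4⟩ | ⟨h3, h4⟩
      · refine Or.inl ⟨h3, fun i hi => ?_⟩
        rcases i with _ | i
        · exact h4
        · exact h2 i (by omega)
      · refine Or.inr ⟨h3, 0, by omega, fun i hi => ?_⟩
        rcases i with _ | i
        · simpa using h4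
        · simpa using h2 i (by omega)
    · rw [h1] at h0
      have h3 : h 0 = false ∧ v 0 = false := by
        revert h0
        cases h 0 <;> cases v 0 <;> simp
      refine Or.inr ⟨h3.1, k + 1, by omega, fun i hi => ?_⟩
      rcases i with _ | i
      · simpa using h3.2
      · simpa using h2 i (by omega)

theorem exists_path_of_rowPartition_ne_zero {x y : R} {a b c d : ℤ → R} {n m : ℕ}
    {v w : ℤ → Bool}
    (hne : rowPartition (fun j => sixWeight x y (a j) (b j) (c j) (d j)) n m v w ≠ 0) :
    ∃ h g : ℕ → Bool, h 0 = g 0 ∧ h m = false ∧ g n = false ∧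
      (∀ i < m, (h i).toNat + (v ((i : ℤ) + 1)).toNat =
        (w ((i : ℤ) + 1)).toNat + (h (i + 1)).toNat) ∧
      (∀ i < n, (g i).toNat + (!v (-(i : ℤ))).toNat =
        (!w (-(i : ℤ))).toNat + (g (i + 1)).toNat) := by
  obtain ⟨e, h0, h1, he⟩ := exists_path_of_prod_matrix_ne_zero _ _ _ _ hne
  refine ⟨fun i => e (n + i), fun i => e (n - i), rfl, h1, by simpa using h0, fun i hi => ?_,
    fun i hi => ?_⟩
  · have := conservation_of_sixWeight_ne_zero (he (n + i) (by omega))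
    rwa [show ((n + i : ℕ) : ℤ) - n + 1 = (i : ℤ) + 1 by push_cast; ring] at this
  · have := conservation_of_sixWeight_ne_zero (he (n - (i + 1)) (by omega))
    rw [show ((n - (i + 1) : ℕ) : ℤ) - n + 1 = -(i : ℤ) by omega,
      show n - (i + 1) + 1 = n - i by omega] at this
    change (e (n - i)).toNat + _ = _ + (e (n - (i + 1))).toNat
    revert this
    generalize e (n - (i + 1)) = s
    generalize e (n - i) = t
    cases s <;> cases t <;> cases v (-(i : ℤ)) <;> cases w (-(i : ℤ)) <;> simp

theorem rowOp_eq_zero_of_eventually {x y : R} {a b c d : ℤ → R} {mu lam : YoungDiagram}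
    (h : ∀ᶠ p : ℕ × ℕ in atTop, rowPartition (fun j => sixWeight x y (a j) (b j) (c j) (d j))
      p.1 p.2 (maya mu) (maya lam) = 0) :
    rowOp x y a b c d mu lam = 0 :=
  stableLimit_eq (h.mono fun p hp => by rw [hp, zero_frac])

open Classical in
/-- The empty diagram and the hooks contained in the hook `(p | q)`. -/
def subHooks (p q : ℕ) : Finset YoungDiagram :=
  insert ⊥ ((Finset.range (p + 1) ×ˢ Finset.range (q + 1)).image fun pq => hook pq.1 pq.2)

theorem mem_subHooks {p q : ℕ} {nu : YoungDiagram} :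
    nu ∈ subHooks p q ↔ nu = ⊥ ∨ ∃ k l, k ≤ p ∧ l ≤ q ∧ nu = hook k l := by
  simp only [subHooks, Finset.mem_insert, Finset.mem_image, Finset.mem_product, Finset.mem_range,
    Prod.exists]
  refine or_congr Iff.rfl (exists_congr fun k => exists_congr fun l => ?_)
  constructor
  · rintro ⟨h, rfl⟩
    exact ⟨by omega, by omega, rfl⟩
  · rintro ⟨h1, h2, rfl⟩
    exact ⟨by omega, rfl⟩

theorem sum_subHooks (p q : ℕ) (f : YoungDiagram → R) :
    ∑ nu ∈ subHooks p q, f nu =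
      f ⊥ + ∑ k ∈ Finset.range (p + 1), ∑ l ∈ Finset.range (q + 1), f (hook k l) := by
  classical
  rw [subHooks, Finset.sum_insert, Finset.sum_image hook_injective.injOn, Finset.sum_product]
  intro h
  obtain ⟨pq, -, h⟩ := Finset.mem_image.mp h
  exact hook_ne_bot _ _ h

theorem rowOp_bot_right_eq_zero {x y : R} {a b c d : ℤ → R} {nu : YoungDiagram} (h : nu ≠ ⊥) :
    rowOp x y a b c d nu ⊥ = 0 := by
  refine rowOp_eq_zero_of_eventually ?_
  filter_upwards [eventually_ge_atTop (nu.colLen 0, nu.rowLen 0)] with ⟨n, m⟩ hnm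
  obtain ⟨hn, hm⟩ := Prod.mk_le_mk.mp hnm
  by_contra hne
  obtain ⟨e, g, heg, em, gn, econs, gcons⟩ := exists_path_of_rowPartition_ne_zero hne
  obtain ⟨-, h1⟩ := eq_false_of_conservation em
    fun i hi => by simpa [maya_bot_pos] using econs i hi
  obtain ⟨-, h2⟩ := eq_false_of_conservation (v := fun i => !maya nu (-(i : ℤ))) gn
    fun i hi => by simpa [maya_bot_neg] using gcons i hi
  refine h (maya_ext (fun i => ?_) fun i => ?_)
  · rw [maya_bot_pos]
    rcases lt_or_ge i m with hi | hi
    · exact h1 i hi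
    · exact maya_eq_false_of_rowLen_le (hm.trans hi)
  · rw [maya_bot_neg]
    rcases lt_or_ge i n with hi | hi
    · simpa using h2 i hi
    · exact maya_eq_true_of_colLen_le (hn.trans hi)

/-- The two halves share the cut edge, so both are fed through it, which gives the empty diagram, or
neither is, which gives a smaller hook. -/
theorem rowOp_hook_right_eq_zero {x y : R} {a b c d : ℤ → R} {nu : YoungDiagram} {p q : ℕ}
    (h : nu ∉ subHooks p q) : rowOp x y a b c d nu (hook p q) = 0 := by
  refine rowOp_eq_zero_of_eventually ?_
  -- The window must contain the particle and hole sites of the hook and every site where `nu`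
  -- differs from the vacuum.
  filter_upwards [eventually_ge_atTop (nu.colLen 0 + q + 1, nu.rowLen 0 + p + 1)] with ⟨n, m⟩ hnm
  obtain ⟨hn, hm⟩ := Prod.mk_le_mk.mp hnm
  by_contra hne
  obtain ⟨e, g, heg, em, gn, econs, gcons⟩ := exists_path_of_rowPartition_ne_zero hne
  have h1 := config_of_conservation (p := p) em (by omega)
    fun i hi => by simpa only [maya_hook_pos] using econs i hi
  have h2 := config_of_conservation (p := q) (v := fun i => !maya nu (-(i : ℤ))) gn (by omega)
    fun i hi => by simpa only [maya_hook_neg_not] using gcons i hi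
  refine h (mem_subHooks.mpr ?_)
  rcases h1 with ⟨h1, h1'⟩ | ⟨h1, k, hk, h1'⟩
  · rcases h2 with ⟨-, h2'⟩ | ⟨h2, -⟩
    · left
      refine maya_ext (fun i => ?_) fun i => ?_
      · rw [maya_bot_pos]
        rcases lt_or_ge i m with hi | hi
        · exact h1' i hi
        · exact maya_eq_false_of_rowLen_le (by omega)
      · rw [maya_bot_neg]
        rcases lt_or_ge i n with hi | hi
        · simpa using h2' i hi
        · exact maya_eq_true_of_colLen_le (by omega)
    · rw [heg, h2] at h1
      cases h1
  · rcases h2 with ⟨h2, -⟩ | ⟨-, l, hl, h2'⟩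
    · rw [heg, h2] at h1
      cases h1
    · right
      refine ⟨k, l, hk, hl, maya_ext (fun i => ?_) fun i => ?_⟩
      · rw [maya_hook_pos]
        rcases lt_or_ge i m with hi | hi
        · exact h1' i hi
        · rw [maya_eq_false_of_rowLen_le (by omega), decide_eq_false (by omega)]
      · rw [maya_hook_neg]
        rcases lt_or_ge i n with hi | hi
        · rw [← h2' i hi, Bool.not_not]
        · rw [maya_eq_true_of_colLen_le (by omega), decide_eq_false (by omega)]
          rfl

/-! ### Products of row operators -/

/-- The finite set `F` is closed under predecessors for `K`, so it contains every intermediate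
diagram; this makes the sums over all diagrams finite. -/
theorem opProd_eq_zero {K : R → R → YoungDiagram → YoungDiagram → R} {F : Finset YoungDiagram}
    (hK : ∀ x y nu, nu ∉ F → ∀ sigma ∈ F, K x y nu sigma = 0) (n : ℕ) (x y : Fin n → R)
    {nu sigma : YoungDiagram} (hnu : nu ∉ F) (hsigma : sigma ∈ F) :
    opProd K n x y nu sigma = 0 := by
  induction n generalizing nu with
  | zero =>
    refine if_neg ?_
    rintro rfl
    exact hnu hsigma
  | succ n ih =>
    refine finsum_eq_zero_of_forall_eq_zero fun tau => ?_
    by_cases htau : tau ∈ F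
    · rw [hK _ _ _ hnu _ htau, zero_mul]
    · rw [ih _ _ htau, mul_zero]

theorem opProd_succ_eq_sum {K : R → R → YoungDiagram → YoungDiagram → R} {F : Finset YoungDiagram}
    (hK : ∀ x y nu, nu ∉ F → ∀ sigma ∈ F, K x y nu sigma = 0) (n : ℕ) (x y : Fin (n + 1) → R)
    (rho : YoungDiagram) {sigma : YoungDiagram} (hsigma : sigma ∈ F) :
    opProd K (n + 1) x y rho sigma =
      ∑ nu ∈ F, K (x 0) (y 0) rho nu * opProd K n (Fin.tail x) (Fin.tail y) nu sigma := by
  refine finsum_eq_sum_of_support_subset _ fun nu hnu => ?_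
  by_contra h
  exact hnu (by
    simp only
    rw [opProd_eq_zero hK n _ _ h hsigma, mul_zero])

theorem opProd_succ_last {K : R → R → YoungDiagram → YoungDiagram → R} {F : Finset YoungDiagram}
    (hK : ∀ x y nu, nu ∉ F → ∀ sigma ∈ F, K x y nu sigma = 0) (n : ℕ) (x y : Fin (n + 1) → R)
    (rho : YoungDiagram) {sigma : YoungDiagram} (hsigma : sigma ∈ F) :
    opProd K (n + 1) x y rho sigma =
      ∑ nu ∈ F, opProd K n (Fin.init x) (Fin.init y) rho nu *
        K (x (Fin.last n)) (y (Fin.last n)) nu sigma := by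
  classical
  induction n generalizing rho with
  | zero =>
    rw [opProd_succ_eq_sum hK _ _ _ _ hsigma]
    have h1 : ∀ nu, K (x 0) (y 0) rho nu * opProd K 0 (Fin.tail x) (Fin.tail y) nu sigma =
        if nu = sigma then K (x 0) (y 0) rho nu else 0 := fun nu => by
      rw [opProd]
      split_ifs <;> simp
    have h2 : ∀ nu, opProd K 0 (Fin.init x) (Fin.init y) rho nu *
        K (x (Fin.last 0)) (y (Fin.last 0)) nu sigma =
        if rho = nu then K (x 0) (y 0) nu sigma else 0 := fun nu => by
      rw [opProd]
      split_ifs <;> simp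
    simp only [h1, h2, Finset.sum_ite_eq, Finset.sum_ite_eq', if_pos hsigma]
    split_ifs with h
    · rfl
    · exact hK _ _ _ h _ hsigma
  | succ n ih =>
    rw [opProd_succ_eq_sum hK _ _ _ _ hsigma]
    simp only [ih, Finset.mul_sum]
    rw [Finset.sum_comm]
    refine Finset.sum_congr rfl fun tau htau => ?_
    rw [opProd_succ_eq_sum hK _ _ _ _ htau, Finset.sum_mul]
    refine Finset.sum_congr rfl fun nu _ => ?_
    rw [mul_assoc]
    rfl

/-- `schur` runs from the empty diagram to the hook, the recursion from the hook to the empty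
diagram. Transposing the operators reverses the order of the rows. -/
theorem opProd_rev {K : R → R → YoungDiagram → YoungDiagram → R} {F : Finset YoungDiagram}
    (hK : ∀ x y nu, nu ∉ F → ∀ sigma ∈ F, K x y nu sigma = 0) (n : ℕ) (x y : Fin n → R)
    (rho : YoungDiagram) {sigma : YoungDiagram} (hsigma : sigma ∈ F) :
    opProd K n x y rho sigma =
      opProd (fun x y nu mu => K x y mu nu) n (fun i => x i.rev) (fun i => y i.rev) sigma rho := by
  induction n generalizing sigma with
  | zero =>
    rw [opProd, opProd]
    by_cases h : rho = sigma
    · rw [if_pos h, if_pos h.symm]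
    · rw [if_neg h, if_neg (Ne.symm h)]
  | succ n ih =>
    rw [opProd_succ_last hK _ _ _ _ hsigma, opProd, finsum_eq_sum_of_support_subset (s := F)]
    · refine Finset.sum_congr rfl fun nu hnu => ?_
      rw [ih _ _ hnu, mul_comm, Fin.rev_zero]
      congr 2 <;>
      · funext i
        simp only [Fin.init, Fin.tail, Fin.rev_succ]
    · intro nu hnu
      by_contra h
      exact hnu (by
        simp only
        rw [hK _ _ _ h _ hsigma, zero_mul])

/-- The factor `g` is a diagonal change of basis on hooks: after conjugation by it, a row acts
exactly as in `hookCore`. -/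
theorem opProd_hook_eq {K : R → R → YoungDiagram → YoungDiagram → R} {A B A' B' : ℕ → R}
    {g : ℕ → ℕ → R} {n : ℕ} {x y : Fin n → R}
    (hbot : ∀ i, ∀ nu, nu ≠ ⊥ → K (x i) (y i) ⊥ nu = 0)
    (hbot_bot : ∀ i, K (x i) (y i) ⊥ ⊥ = 1)
    (hsub : ∀ i, ∀ p q, ∀ nu, nu ∉ subHooks p q → K (x i) (y i) (hook p q) nu = 0)
    (hentry : ∀ i, ∀ p q, K (x i) (y i) (hook p q) ⊥ =
      g p q * ((x i + y i) * (entryCoeff A B (x i) p * entryCoeff A' B' (y i) q)))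
    (hpass : ∀ i, ∀ k l p q, k ≤ p → l ≤ q → K (x i) (y i) (hook p q) (hook k l) * g k l =
      g p q * (passCoeff A B (x i) (y i) k p * passCoeff A' B' (y i) (x i) l q)) (p q : ℕ) :
    opProd K n x y (hook p q) ⊥ = g p q * hookCore A B A' B' n x y p q := by
  have h1 : opProd K n x y ⊥ ⊥ = 1 := by
    clear hsub hentry hpass
    induction n with
    | zero => exact if_pos rfl
    | succ n ih =>
      rw [opProd, finsum_eq_single _ ⊥ fun nu hnu => by rw [hbot 0 nu hnu, zero_mul], hbot_bot,
        ih (x := Fin.tail x) (y := Fin.tail y) (fun i => hbot _) (fun i => hbot_bot _), one_mul]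
  induction n generalizing p q with
  | zero =>
    rw [hookCore, mul_zero]
    exact if_neg (hook_ne_bot p q)
  | succ n ih =>
    have h2 : opProd K n (Fin.tail x) (Fin.tail y) ⊥ ⊥ = 1 := by
      rwa [opProd, finsum_eq_single _ ⊥ fun nu hnu => by rw [hbot 0 nu hnu, zero_mul], hbot_bot,
        one_mul] at h1
    have ih' := ih (x := Fin.tail x) (y := Fin.tail y) (fun i => hbot _) (fun i => hbot_bot _)
      (fun i => hsub _) (fun i => hentry _) (fun i => hpass _) (h1 := h2)
    rw [opProd, finsum_eq_sum_of_support_subset (s := subHooks p q), sum_subHooks, h2, mul_one,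
      hentry, hookCore, mul_add]
    · congr 1
      simp only [passSum, Finset.sum_mul, Finset.mul_sum]
      refine Finset.sum_congr rfl fun k hk => Finset.sum_congr rfl fun l hl => ?_
      have := hpass 0 k l p q (by simp at hk; omega) (by simp at hl; omega)
      rw [ih']
      linear_combination hookCore A B A' B' n (Fin.tail x) (Fin.tail y) k l * this
    · intro nu hnu
      by_contra h
      exact hnu (by
        simp only
        rw [hsub 0 _ _ _ h, zero_mul])

theorem stepCoeff_eq_passCoeff (A B : ℕ → R) (x y : R) (k p : ℕ) :
    stepCoeff x y A B (fun i => 1 - A i * B i) (fun _ => x + y) k p = passCoeff A B x y k p :=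
  rfl

/-- When `1 - AB` is collected at the end of a step instead of its start, diagonal conjugation moves
it back. -/
theorem stepCoeff_mul (A B : ℕ → R) (x y : R) (k p : ℕ) :
    stepCoeff x y A B (fun _ => x + y) (fun i => 1 - A i * B i) k p * (1 - A k * B k) =
      (1 - A p * B p) * passCoeff A B x y k p := by
  unfold stepCoeff passCoeff
  split_ifs with h
  · rw [h, mul_comm]
  · simp only [edgeCoeff, frac]
    ring

theorem dualSchur_hook {a b : ℤ → R} {n : ℕ} {x y : Fin n → R}
    (hx : ∀ i p, IsUnit (1 - positivePart a p * x i))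
    (hy : ∀ i p, IsUnit (1 - positivePart (dualSeq a) p * y i)) (p q : ℕ) :
    dualSchur (hook p q) ⊥ a b x y = (1 - positivePart b p * positivePart a p) *
      hookCore (positivePart b) (positivePart a) (positivePart (dualSeq b))
        (positivePart (dualSeq a)) n x y p q := by
  refine opProd_hook_eq (g := fun p _ => 1 - positivePart b p * positivePart a p)
    (fun i nu hnu => ?_) (fun i => ?_) (fun i p q nu hnu => ?_) (fun i p q => ?_)
    (fun i k l p q hkp hlq => ?_) p q
  all_goals rw [dualOpA_eq_rowOp]
  · exact rowOp_bot_right_eq_zero hnu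
  · exact rowOp_bot_bot (hx i) (hy i)
  · exact rowOp_hook_right_eq_zero hnu
  · rw [rowOp_bot_hook (hx i) (hy i)]
    simp only [positivePart]
    ring
  · rw [rowOp_hook_hook (hx i) (hy i) hkp hlq]
    have h1 := stepCoeff_mul (positivePart b) (positivePart a) (x i) (y i) k p
    have h2 := stepCoeff_eq_passCoeff (positivePart (dualSeq b)) (positivePart (dualSeq a)) (y i)
      (x i) l q
    have h3 : (fun i => 1 - positivePart (dualSeq b) i * positivePart (dualSeq a) i) =
        fun i : ℕ => 1 - b (-(i : ℤ)) * a (-(i : ℤ)) := by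
      funext i
      rw [positivePart_dualSeq, positivePart_dualSeq, neg_mul_neg]
    rw [h3, add_comm (y i)] at h2
    have h4 : positivePart (fun _ : ℤ => x i + y i) = fun _ => x i + y i := rfl
    have h5 : positivePart (fun j => 1 - b j * a j) =
        fun i => 1 - positivePart b i * positivePart a i := rfl
    rw [h2, h4, h5]
    linear_combination passCoeff (positivePart (dualSeq b)) (positivePart (dualSeq a)) (y i)
      (x i) l q * h1

theorem schur_hook {a b : ℤ → R} {n : ℕ} {x y : Fin n → R}
    (hx : ∀ i p, IsUnit (1 - positivePart b p * x i))
    (hy : ∀ i p, IsUnit (1 - positivePart (dualSeq b) p * y i)) (p q : ℕ) :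
    schur (hook p q) ⊥ a b x y =
      (1 - positivePart (dualSeq a) q * positivePart (dualSeq b) q) *
      hookCore (positivePart a) (positivePart b) (positivePart (dualSeq a))
        (positivePart (dualSeq b)) n (fun i => x i.rev) (fun i => y i.rev) p q := by
  have hF : ∀ (x y : R) (nu : YoungDiagram), nu ∉ subHooks p q → ∀ sigma ∈ subHooks p q,
      opA a b x y nu sigma = 0 := fun x y nu hnu sigma hsigma => by
    rw [opA_eq_rowOp]
    rcases mem_subHooks.mp hsigma with rfl | ⟨k, l, hk, hl, rfl⟩
    · exact rowOp_bot_right_eq_zero fun h => hnu (mem_subHooks.mpr (Or.inl h))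
    · refine rowOp_hook_right_eq_zero fun h => hnu (mem_subHooks.mpr ?_)
      rcases mem_subHooks.mp h with h | ⟨k', l', hk', hl', h⟩
      · exact Or.inl h
      · exact Or.inr ⟨k', l', hk'.trans hk, hl'.trans hl, h⟩
  rw [schur, opProd_rev hF _ _ _ _ (mem_subHooks.mpr (Or.inr ⟨p, q, le_rfl, le_rfl, rfl⟩))]
  refine opProd_hook_eq
    (g := fun _ q => 1 - positivePart (dualSeq a) q * positivePart (dualSeq b) q)
    (fun i nu hnu => ?_) (fun i => ?_) (fun i p q nu hnu => ?_) (fun i p q => ?_)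
    (fun i k l p q hkp hlq => ?_) p q
  all_goals simp only [opA_eq_rowOp]
  · exact rowOp_bot_right_eq_zero hnu
  · exact rowOp_bot_bot (hx _) (hy _)
  · exact rowOp_hook_right_eq_zero hnu
  · rw [rowOp_bot_hook (hx _) (hy _), positivePart_dualSeq, positivePart_dualSeq]
    ring
  · rw [rowOp_hook_hook (hx _) (hy _) hkp hlq]
    have h1 := stepCoeff_mul (positivePart (dualSeq a)) (positivePart (dualSeq b)) (y i.rev)
      (x i.rev) l q
    have h2 := stepCoeff_eq_passCoeff (positivePart a) (positivePart b) (x i.rev) (y i.rev) k p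
    have h3 : (fun i => 1 - positivePart (dualSeq a) i * positivePart (dualSeq b) i) =
        fun i : ℕ => 1 - a (-(i : ℤ)) * b (-(i : ℤ)) := by
      funext i
      rw [positivePart_dualSeq, positivePart_dualSeq, neg_mul_neg]
    rw [h3, add_comm (y i.rev)] at h1
    have h4 : positivePart (fun _ : ℤ => x i.rev + y i.rev) = fun _ => x i.rev + y i.rev := rfl
    have h5 : positivePart (fun j => 1 - a j * b j) =
        fun i => 1 - positivePart a i * positivePart b i := rfl
    rw [h4, h5, h2]
    linear_combination passCoeff (positivePart a) (positivePart b) (x i.rev) (y i.rev) k p * h1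

/-! ### The generating series -/

/-- The summand of the generating series of the functions `hookCore`. -/
def coreTerm (A B A' B' : ℕ → R) {n : ℕ} (x y : Fin n → R) (z w : R) (pq : ℕ × ℕ) : R :=
  hookCore A B A' B' n x y pq.1 pq.2 * genCoeff A B z pq.1 * genCoeff A' B' w pq.2

theorem mul_frac_shiftedPow (a b : ℤ → R) (z : R) (p : ℕ) :
    (1 - positivePart a p * positivePart b p) *
      frac (shiftedPow z b p) (coshiftedPow z a (p + 1)) =
      genCoeff (positivePart a) (positivePart b) z p := by
  rw [genCoeff, ratioPow, prod_frac, frac_mul_frac, shiftedPow, coshiftedPow,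
    Finset.prod_range_succ]
  simp only [positivePart, frac]
  ring

theorem hookTerm_eq_coreTerm {a b : ℤ → R} {n : ℕ} {x y : Fin n → R} (z w : R)
    (hx : ∀ i p, IsUnit (1 - positivePart b p * x i))
    (hy : ∀ i p, IsUnit (1 - positivePart (dualSeq b) p * y i)) :
    hookTerm a b x y z w = coreTerm (positivePart a) (positivePart b) (positivePart (dualSeq a))
      (positivePart (dualSeq b)) (fun i => x i.rev) (fun i => y i.rev) z w := by
  funext ⟨p, q⟩
  rw [hookTerm, schur_hook hx hy, coreTerm, ← mul_frac_shiftedPow, ← mul_frac_shiftedPow]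
  simp only [positivePart]
  ring

theorem dualHookTerm_eq_coreTerm {a b : ℤ → R} {n : ℕ} {x y : Fin n → R} (z w : R)
    (hx : ∀ i p, IsUnit (1 - positivePart a p * x i))
    (hy : ∀ i p, IsUnit (1 - positivePart (dualSeq a) p * y i)) :
    dualHookTerm a b x y z w = coreTerm (positivePart b) (positivePart a)
      (positivePart (dualSeq b)) (positivePart (dualSeq a)) x y z w := by
  funext ⟨p, q⟩
  rw [dualHookTerm, dualSchur_hook hx hy, coreTerm, ← mul_frac_shiftedPow, ← mul_frac_shiftedPow]
  simp only [positivePart]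
  ring

theorem eq_prod_frac_of_mul_eq {n : ℕ} {x y : Fin n → R} {z w t : R}
    (hxz : ∀ i, IsUnit (1 - x i * z)) (hyw : ∀ i, IsUnit (1 - y i * w))
    (h : (∏ i, (1 - x i * z) * (1 - y i * w)) * t = ∏ i, (1 + y i * z) * (1 + x i * w)) :
    t = ∏ i, frac (1 + y i * z) (1 - x i * z) * frac (1 + x i * w) (1 - y i * w) := by
  simp only [frac_mul_frac]
  rw [prod_frac]
  refine (frac_eq_of_mul_eq ?_ ?_).symm
  · rw [IsUnit.prod_univ_iff]
    exact fun i => (hxz i).mul (hyw i)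
  · rw [mul_comm, h]

theorem prod_frac_exchange {n : ℕ} (x y : Fin n → R) (z w : R) :
    ∏ i, frac (1 + x i * w) (1 - x i * z) * frac (1 + y i * z) (1 - y i * w) =
      ∏ i, frac (1 + y i * z) (1 - x i * z) * frac (1 + x i * w) (1 - y i * w) := by
  refine Finset.prod_congr rfl fun i _ => ?_
  simp only [frac]
  ring

/-- The condition under which a series breaks off, for sequences indexed by natural numbers. -/
def CoreBreaksOff {T : Type*} (A B : ℕ → T) {n : ℕ} (u : Fin n → T) (t : T) : Prop :=
  (∃ l, t = B l) ∨ ∃ l : Fin n → ℕ, Function.Injective l ∧ ∀ i, u i = A (l i)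

theorem BreaksOff.coreBreaksOff {a b : ℤ → R} {n : ℕ} {u : Fin n → R} {t : R}
    (h : BreaksOff a b u t) : CoreBreaksOff (positivePart a) (positivePart b) u t := by
  rcases h with ⟨l, hl, rfl⟩ | ⟨l, hl, h⟩
  · refine Or.inl ⟨(l - 1).toNat, ?_⟩
    rw [positivePart, show (((l - 1).toNat : ℤ) + 1) = l by omega]
  · refine Or.inr ⟨fun i => (l i - 1).toNat, fun i j hij => hl ?_, fun i => ?_⟩
    · have := (h i).1
      have := (h j).1
      simp only at hij
      omega
    · rw [positivePart, (h i).2, show (((l i - 1).toNat : ℤ) + 1) = l i by have := (h i).1; omega]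

theorem CoreBreaksOff.rev {T : Type*} {A B : ℕ → T} {n : ℕ} {u : Fin n → T} {t : T}
    (h : CoreBreaksOff A B u t) : CoreBreaksOff A B (fun i => u i.rev) t := by
  rcases h with h | ⟨l, hl, h⟩
  · exact Or.inl h
  · exact Or.inr ⟨fun i => l i.rev, hl.comp Fin.rev_injective, fun i => h _⟩

/-- The denominators on the product side are among the given ones: `1 - b_l x_i` if `z = b_l`, and
`1 - a_l z` if `x_i = a_l`. -/
theorem CoreBreaksOff.isUnit {A B : ℕ → R} {n : ℕ} {x : Fin n → R} {z : R}
    (h : CoreBreaksOff A B x z) (hx : ∀ i p, IsUnit (1 - B p * x i))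
    (hz : ∀ p, IsUnit (1 - A p * z)) (i : Fin n) : IsUnit (1 - x i * z) := by
  rcases h with ⟨l, rfl⟩ | ⟨l, -, h⟩
  · rw [mul_comm]
    exact hx i l
  · rw [h]
    exact hz _

theorem CoreBreaksOff.exists_bound {A B : ℕ → R} {n : ℕ} {x y : Fin n → R} {z : R}
    (h : CoreBreaksOff A B x z) {B' : ℕ → R} (A' : ℕ → R) (hx : ∀ i p, IsUnit (1 - B p * x i))
    (hy : ∀ i p, IsUnit (1 - B' p * y i)) :
    ∃ m₀, ∀ m, m₀ ≤ m → RemainderVanishes A B A' B' z m n x y ∧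
      ∀ q, hookCore A B A' B' n x y m q * genCoeff A B z m = 0 := by
  rcases h with ⟨l, rfl⟩ | ⟨l, hl, h⟩
  · refine ⟨l + 1, fun m hm => ?_⟩
    have h0 : ratioPow B A (B l) m = 0 := ratioPow_eq_zero (by omega)
    exact ⟨remainderVanishes_of_ratioPow h0 n x y, fun q => by rw [genCoeff, h0]; ring⟩
  · obtain rfl : x = fun i => A (l i) := funext h
    -- Any number exceeding every `l i` would do.
    refine ⟨∑ i, (l i + 1), fun m hm => ?_⟩
    have hlm : ∀ i, l i < m := fun i => by
      have := Finset.single_le_sum (f := fun i => l i + 1) (fun _ _ => Nat.zero_le _)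
        (Finset.mem_univ i)
      omega
    exact ⟨remainderVanishes_of_injective hx hy hl hlm, fun q => by
      rw [hookCore_eq_zero hx hy hl hlm, zero_mul]⟩

theorem finsum_coreTerm {A B A' B' : ℕ → R} {n : ℕ} {x y : Fin n → R} {z w : R}
    (hx : ∀ i p, IsUnit (1 - B p * x i)) (hy : ∀ i p, IsUnit (1 - B' p * y i))
    (hz : ∀ p, IsUnit (1 - A p * z)) (hw : ∀ p, IsUnit (1 - A' p * w))
    (h : CoreBreaksOff A B x z) (h' : CoreBreaksOff A' B' y w) :
    (Function.support (coreTerm A B A' B' x y z w)).Finite ∧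
      1 + (z + w) * ∑ᶠ pq, coreTerm A B A' B' x y z w pq =
        ∏ i, frac (1 + y i * z) (1 - x i * z) * frac (1 + x i * w) (1 - y i * w) := by
  obtain ⟨m₁, h₁⟩ := h.exists_bound A' hx hy
  obtain ⟨m₂, h₂⟩ := h'.exists_bound A hy hx
  set m := max m₁ m₂
  have hsupp : Function.support (coreTerm A B A' B' x y z w) ⊆
      (Finset.range m ×ˢ Finset.range m : Finset (ℕ × ℕ)) := by
    rintro ⟨p, q⟩ hpq
    rw [Function.mem_support, coreTerm] at hpq
    by_contra hmem
    simp only [Finset.coe_product, Set.mem_prod, Finset.mem_coe, Finset.mem_range] at hmem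
    rcases lt_or_ge p m with hp | hp
    · refine hpq ?_
      have := (h₂ q (by omega)).2 p
      rw [hookCore_swap] at this
      simp only
      linear_combination genCoeff A B z p * this
    · exact hpq (by simp only; rw [(h₁ p (by omega)).2, zero_mul])
  refine ⟨(Finset.finite_toSet _).subset hsupp, ?_⟩
  refine eq_prod_frac_of_mul_eq (h.isUnit hx hz) (h'.isUnit hy hw) ?_
  rw [finsum_eq_sum_of_support_subset _ hsupp, Finset.sum_product]
  exact sum_hookCore_mul_genCoeff hx hy hz hw (h₁ m (le_max_left _ _)).1 (h₂ m (le_max_right _ _)).1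

/-! ### Convergence and the identity for formal power series -/

section PowerSeries

open MvPowerSeries

variable {σ k : Type*} [CommRing k]

/-- The ideal of the power series without terms of degree less than `m`. -/
def orderIdeal (σ k : Type*) [CommRing k] (m : ℕ) : Ideal (MvPowerSeries σ k) where
  carrier := {f | (m : ℕ∞) ≤ f.order}
  add_mem' hf hg := (le_min hf hg).trans min_order_le_add
  zero_mem' := by simp
  smul_mem' f _ hg := (le_add_left hg).trans (le_order_mul (f := f))

theorem mem_orderIdeal {m : ℕ} {f : MvPowerSeries σ k} :
    f ∈ orderIdeal σ k m ↔ (m : ℕ∞) ≤ f.order := Iff.rfl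

theorem isUnit_one_sub_mul {f g : MvPowerSeries σ k} (hf : constantCoeff f = 0) :
    IsUnit (1 - f * g) := by
  rw [isUnit_iff_constantCoeff]
  simp [hf]

theorem ratioPow_mem_orderIdeal {A B : ℕ → MvPowerSeries σ k} {z : MvPowerSeries σ k}
    (hB : ∀ p, constantCoeff (B p) = 0) (hz : constantCoeff z = 0) (m : ℕ) :
    ratioPow B A z m ∈ orderIdeal σ k m := by
  induction m with
  | zero => simp [mem_orderIdeal]
  | succ m ih =>
    rw [ratioPow_succ, frac, ← mul_assoc]
    refine Ideal.mul_mem_right _ _ (mem_orderIdeal.mpr ?_)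
    have h1 : 1 ≤ (z - B m).order := by
      rw [one_le_order_iff_constCoeff_eq_zero]
      simp [hB, hz]
    push_cast
    exact (add_le_add (mem_orderIdeal.mp ih) h1).trans le_order_mul

theorem hasSum_coreTerm [TopologicalSpace k] {A B A' B' : ℕ → MvPowerSeries σ k}
    {n : ℕ} {x y : Fin n → MvPowerSeries σ k} {z w : MvPowerSeries σ k}
    (hA : ∀ p, constantCoeff (A p) = 0) (hB : ∀ p, constantCoeff (B p) = 0)
    (hA' : ∀ p, constantCoeff (A' p) = 0) (hB' : ∀ p, constantCoeff (B' p) = 0)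
    (hx : ∀ i, constantCoeff (x i) = 0) (hy : ∀ i, constantCoeff (y i) = 0)
    (hz : constantCoeff z = 0) (hw : constantCoeff w = 0) :
    ∃ S, HasSum (coreTerm A B A' B' x y z w) S ∧
      1 + (z + w) * S =
        ∏ i, frac (1 + y i * z) (1 - x i * z) * frac (1 + x i * w) (1 - y i * w) := by
  have hux : ∀ i p, IsUnit (1 - B p * x i) := fun i p => isUnit_one_sub_mul (hB p)
  have huy : ∀ i p, IsUnit (1 - B' p * y i) := fun i p => isUnit_one_sub_mul (hB' p)
  have huz : ∀ p, IsUnit (1 - A p * z) := fun p => isUnit_one_sub_mul (hA p)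
  have huw : ∀ p, IsUnit (1 - A' p * w) := fun p => isUnit_one_sub_mul (hA' p)
  set f := coreTerm A B A' B' x y z w
  -- A term outside the `m × m` square contains a shifted power in `z` or `w` with at least `m`
  -- factors, each without constant term.
  have hcoeff : ∀ (d : σ →₀ ℕ) (m : ℕ), d.degree < m →
      ∀ pq ∉ Finset.range m ×ˢ Finset.range m, coeff d (f pq) = 0 := by
    rintro d m hd ⟨p, q⟩ hpq
    refine coeff_of_lt_order (lt_of_lt_of_le (Nat.cast_lt.mpr hd) (mem_orderIdeal.mp ?_))
    simp only [Finset.mem_product, Finset.mem_range, not_and_or, not_lt] at hpq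
    have hmono : ∀ {p : ℕ} {g : MvPowerSeries σ k}, m ≤ p → g ∈ orderIdeal σ k p →
        g ∈ orderIdeal σ k m := fun hp hg =>
      mem_orderIdeal.mpr ((Nat.cast_le.mpr hp).trans (mem_orderIdeal.mp hg))
    simp only [f, coreTerm, genCoeff]
    rcases hpq with hp | hq
    · exact Ideal.mul_mem_right _ _ (Ideal.mul_mem_left _ _ (Ideal.mul_mem_right _ _
        (hmono hp (ratioPow_mem_orderIdeal hB hz p))))
    · exact Ideal.mul_mem_left _ _ (Ideal.mul_mem_right _ _
        (hmono hq (ratioPow_mem_orderIdeal hB' hw q)))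
  let S : MvPowerSeries σ k := fun d =>
    ∑ pq ∈ Finset.range (d.degree + 1) ×ˢ Finset.range (d.degree + 1), coeff d (f pq)
  have hS : ∀ d, coeff d S =
      ∑ pq ∈ Finset.range (d.degree + 1) ×ˢ Finset.range (d.degree + 1), coeff d (f pq) :=
    fun d => rfl
  refine ⟨S, ?_, ?_⟩
  · rw [WithPiTopology.hasSum_iff_hasSum_coeff]
    intro d
    rw [hS]
    exact hasSum_sum_of_ne_finset_zero (hcoeff d _ (Nat.lt_succ_self _))
  · refine eq_prod_frac_of_mul_eq (fun i => isUnit_one_sub_mul (hx i))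
      (fun i => isUnit_one_sub_mul (hy i)) (sub_eq_zero.mp (order_eq_top_iff.mp ?_))
    refine ENat.eq_top_iff_forall_ge.mpr fun m => ?_
    rw [← mem_orderIdeal, ← Ideal.Quotient.eq_zero_iff_mem, map_sub, sub_eq_zero]
    -- Modulo order `m` the series equals its truncation and the boundary terms vanish, so the
    -- truncated identity applies in the quotient ring.
    set π := Ideal.Quotient.mk (orderIdeal σ k m)
    have hSm : π S = π (∑ pq ∈ Finset.range m ×ˢ Finset.range m, f pq) := by
      rw [← sub_eq_zero, ← map_sub, Ideal.Quotient.eq_zero_iff_mem, mem_orderIdeal]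
      refine nat_le_order fun d hd => ?_
      rw [map_sub, hS, map_sum, sub_eq_zero]
      refine Finset.sum_subset (Finset.product_subset_product (Finset.range_mono hd)
        (Finset.range_mono hd)) fun pq _ hpq => hcoeff d _ (Nat.lt_succ_self _) pq hpq
    have hmap : ∀ {u v : MvPowerSeries σ k}, IsUnit (1 - u * v) → IsUnit (1 - π u * π v) :=
      fun h => by simpa using h.map π
    have key := sum_hookCore_mul_genCoeff (A := fun p => π (A p)) (B := fun p => π (B p))
      (A' := fun p => π (A' p)) (B' := fun p => π (B' p)) (x := fun i => π (x i))
      (y := fun i => π (y i)) (z := π z) (w := π w) (m := m)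
      (fun i p => hmap (hux i p)) (fun i p => hmap (huy i p)) (fun p => hmap (huz p))
      (fun p => hmap (huw p))
      (remainderVanishes_of_ratioPow (by
        rw [← map_ratioPow π huz, Ideal.Quotient.eq_zero_iff_mem]
        exact ratioPow_mem_orderIdeal hB hz m) _ _ _)
      (remainderVanishes_of_ratioPow (by
        rw [← map_ratioPow π huw, Ideal.Quotient.eq_zero_iff_mem]
        exact ratioPow_mem_orderIdeal hB' hw m) _ _ _)
    rw [map_mul, map_add, map_mul π (z + w), hSm, Finset.sum_product]
    simp only [f, coreTerm, map_sum, map_mul, map_prod, map_add, map_sub, map_one,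
      map_hookCore π hux huy, map_genCoeff π huz, map_genCoeff π huw]
    simpa only using key

end PowerSeries

/-! ### The two identities for the hook functions -/

theorem Nondegenerate.isUnit_positivePart {a b : ℤ → R} {n : ℕ} {x y : Fin n → R} {z w : R}
    (h : Nondegenerate a b x y z w) :
    (∀ i p, IsUnit (1 - positivePart b p * x i)) ∧
      (∀ i p, IsUnit (1 - positivePart (dualSeq b) p * y i)) ∧
      (∀ p, IsUnit (1 - positivePart a p * z)) ∧
      (∀ p, IsUnit (1 - positivePart (dualSeq a) p * w)) :=
  ⟨fun i p => h.isUnit_x i _ (by omega), fun i p => h.isUnit_y i _ (by omega),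
    fun p => h.isUnit_z _ (by omega), fun p => h.isUnit_w _ (by omega)⟩

theorem prod_frac_rev {n : ℕ} (x y : Fin n → R) (z w : R) :
    ∏ i : Fin n, frac (1 + y i.rev * z) (1 - x i.rev * z) *
        frac (1 + x i.rev * w) (1 - y i.rev * w) =
      ∏ i, frac (1 + y i * z) (1 - x i * z) * frac (1 + x i * w) (1 - y i * w) :=
  Equiv.prod_comp Fin.revPerm
    fun i => frac (1 + y i * z) (1 - x i * z) * frac (1 + x i * w) (1 - y i * w)

theorem finsum_hookTerm {a b : ℤ → R} {n : ℕ} {x y : Fin n → R} {z w : R}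
    (h : Nondegenerate a b x y z w) (hz : BreaksOff a b x z)
    (hw : BreaksOff (dualSeq a) (dualSeq b) y w) :
    (Function.support (hookTerm a b x y z w)).Finite ∧
      1 + (z + w) * ∑ᶠ pq, hookTerm a b x y z w pq =
        ∏ i, frac (1 + y i * z) (1 - x i * z) * frac (1 + x i * w) (1 - y i * w) := by
  obtain ⟨h1, h2, h3, h4⟩ := h.isUnit_positivePart
  rw [hookTerm_eq_coreTerm z w h1 h2, ← prod_frac_rev]
  exact finsum_coreTerm (fun i => h1 _) (fun i => h2 _) h3 h4 hz.coreBreaksOff.rev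
    hw.coreBreaksOff.rev

theorem finsum_dualHookTerm {a b : ℤ → R} {n : ℕ} {x y : Fin n → R} {z w : R}
    (h : Nondegenerate b a x y z w) (hz : BreaksOff b a x z)
    (hw : BreaksOff (dualSeq b) (dualSeq a) y w) :
    (Function.support (dualHookTerm a b x y z w)).Finite ∧
      1 + (z + w) * ∑ᶠ pq, dualHookTerm a b x y z w pq =
        ∏ i, frac (1 + x i * w) (1 - x i * z) * frac (1 + y i * z) (1 - y i * w) := by
  obtain ⟨h1, h2, h3, h4⟩ := h.isUnit_positivePart
  rw [dualHookTerm_eq_coreTerm z w h1 h2, prod_frac_exchange]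
  exact finsum_coreTerm h1 h2 h3 h4 hz.coreBreaksOff hw.coreBreaksOff

theorem hasSum_hookTerm {σ k : Type*} [CommRing k] [TopologicalSpace k]
    {a b : ℤ → MvPowerSeries σ k} {n : ℕ} {x y : Fin n → MvPowerSeries σ k}
    {z w : MvPowerSeries σ k}
    (ha : ∀ j, MvPowerSeries.constantCoeff (a j) = 0)
    (hb : ∀ j, MvPowerSeries.constantCoeff (b j) = 0)
    (hx : ∀ i, MvPowerSeries.constantCoeff (x i) = 0)
    (hy : ∀ i, MvPowerSeries.constantCoeff (y i) = 0)
    (hz : MvPowerSeries.constantCoeff z = 0) (hw : MvPowerSeries.constantCoeff w = 0) :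
    (∃ S, HasSum (hookTerm a b x y z w) S ∧
      1 + (z + w) * S =
        ∏ i, frac (1 + y i * z) (1 - x i * z) * frac (1 + x i * w) (1 - y i * w)) ∧
    (∃ S, HasSum (dualHookTerm a b x y z w) S ∧
      1 + (z + w) * S =
        ∏ i, frac (1 + x i * w) (1 - x i * z) * frac (1 + y i * z) (1 - y i * w)) := by
  have hdual : ∀ {c : ℤ → MvPowerSeries σ k}, (∀ j, MvPowerSeries.constantCoeff (c j) = 0) →
      ∀ p, MvPowerSeries.constantCoeff (positivePart (dualSeq c) p) = 0 := fun hc p => by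
    rw [positivePart_dualSeq, map_neg, hc, neg_zero]
  have hpos : ∀ {c : ℤ → MvPowerSeries σ k}, (∀ j, MvPowerSeries.constantCoeff (c j) = 0) →
      ∀ p, MvPowerSeries.constantCoeff (positivePart c p) = 0 := fun hc p => hc _
  constructor
  · rw [hookTerm_eq_coreTerm z w (fun i p => isUnit_one_sub_mul (hpos hb p))
      (fun i p => isUnit_one_sub_mul (hdual hb p)), ← prod_frac_rev]
    exact hasSum_coreTerm (hpos ha) (hpos hb) (hdual ha) (hdual hb) (fun i => hx _)
      (fun i => hy _) hz hw
  · rw [dualHookTerm_eq_coreTerm z w (fun i p => isUnit_one_sub_mul (hpos ha p))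
      (fun i p => isUnit_one_sub_mul (hdual ha p)), prod_frac_exchange]
    exact hasSum_coreTerm (hpos hb) (hpos ha) (hdual hb) (hdual ha) hx hy hz hw

end

end FreeFermionic

theorem mainTheorem11 (n : ℕ) :
    -- both identities in the algebraic sense, over any commutative ring
    (∀ (R : Type*) [CommRing R] (a b : ℤ → R) (x y : Fin n → R) (z w : R),
      (FreeFermionic.Nondegenerate a b x y z w →
        FreeFermionic.BreaksOff a b x z →
        FreeFermionic.BreaksOff (FreeFermionic.dualSeq a) (FreeFermionic.dualSeq b) y w →
        (Function.support (FreeFermionic.hookTerm a b x y z w)).Finite ∧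
        1 + (z + w) * ∑ᶠ pq : ℕ × ℕ, FreeFermionic.hookTerm a b x y z w pq =
          ∏ i, FreeFermionic.frac (1 + y i * z) (1 - x i * z) *
            FreeFermionic.frac (1 + x i * w) (1 - y i * w)) ∧
      (FreeFermionic.Nondegenerate b a x y z w →
        FreeFermionic.BreaksOff b a x z →
        FreeFermionic.BreaksOff (FreeFermionic.dualSeq b) (FreeFermionic.dualSeq a) y w →
        (Function.support (FreeFermionic.dualHookTerm a b x y z w)).Finite ∧
        1 + (z + w) * ∑ᶠ pq : ℕ × ℕ, FreeFermionic.dualHookTerm a b x y z w pq =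
          ∏ i, FreeFermionic.frac (1 + x i * w) (1 - x i * z) *
            FreeFermionic.frac (1 + y i * z) (1 - y i * w))) ∧
    -- both identities for independent indeterminates, as formal power series whose coefficients
    -- lie in a discrete ring `k`
    (∀ (k : Type*) [CommRing k] [TopologicalSpace k] [DiscreteTopology k]
      (a b : ℤ → MvPowerSeries (FreeFermionic.Indet n) k)
      (x y : Fin n → MvPowerSeries (FreeFermionic.Indet n) k)
      (z w : MvPowerSeries (FreeFermionic.Indet n) k),
      (∀ j, a j = MvPowerSeries.X (.a j)) → (∀ j, b j = MvPowerSeries.X (.b j)) →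
      (∀ i, x i = MvPowerSeries.X (.x i)) → (∀ i, y i = MvPowerSeries.X (.y i)) →
      z = MvPowerSeries.X .z → w = MvPowerSeries.X .w →
      (∃ S, HasSum (FreeFermionic.hookTerm a b x y z w) S ∧
        1 + (z + w) * S =
          ∏ i, FreeFermionic.frac (1 + y i * z) (1 - x i * z) *
            FreeFermionic.frac (1 + x i * w) (1 - y i * w)) ∧
      (∃ S, HasSum (FreeFermionic.dualHookTerm a b x y z w) S ∧
        1 + (z + w) * S =
          ∏ i, FreeFermionic.frac (1 + x i * w) (1 - x i * z) *
            FreeFermionic.frac (1 + y i * z) (1 - y i * w))) := by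
  refine ⟨fun R _ a b x y z w => ⟨FreeFermionic.finsum_hookTerm,
    FreeFermionic.finsum_dualHookTerm⟩, fun k _ _ _ a b x y z w ha hb hx hy hz hw => ?_⟩
  exact FreeFermionic.hasSum_hookTerm (fun j => by simp [ha]) (fun j => by simp [hb])
    (fun i => by simp [hx]) (fun i => by simp [hy]) (by simp [hz]) (by simp [hw])
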